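/- **Theorem (WFE's cleanup() is safe for memory reclamation).** Consider the Wait-Free Eras (WFE) scheme run by $n$ threads under sequential consistency, every step performing at most one atomic access to memory shared between threads. Eras and tags are natural numbers that do not overflow, and $\infty$ means "no reservation". *Shared data.* There are a global era clock and two counters $\mathit{counter\_start},\mathit{counter\_end}$. Each thread has reservations, which are pairs (era, tag): $m=\mathit{max\_hes}$ normal ones and two special ones. Each normal reservation $(i,j)$ has a slow-path state (pointer, era, result). Each block has an $\mathit{alloc\_era}$ and a $\mathit{retire\_era}$, stamped from the clock by $\mathit{alloc\_block}()$ and $\mathit{retire}()$. Reclaimed addresses may be allocated again. *get_protected(ptr, index, parent).* Fast path: load $*ptr$ and return it if the era already published in the normal reservation $\mathit{index}$ equals the clock; otherwise publish the clock value and retry. After any number of attempts the thread takes the slow path: it increments $\mathit{counter\_start}$, stores $ptr$ and the parent's $\mathit{alloc\_era}$ ($\infty$ if the parent is null) in its state, and sets its result to $(\mathbf{invptr},\mathit{tag})$, where $\mathit{tag}$ is the tag of the reservation. It then repeats the loop. If its own attempt succeeds, it cancels the request by a wide CAS on the result; otherwise it updates its reservation by a wide CAS on (era, tag). It stops when a helper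 has produced a result (pointer, era); it then writes that era into its reservation. In both cases it finally increments the tag of the reservation and $\mathit{counter\_end}$, and returns the pointer. *increment_era()*, called at arbitrary times by $\mathit{alloc\_block}()$ and $\mathit{retire}()$: if the two counters differ, it calls $\mathit{help\_thread}(i,j)$ for every pending request; then it increments the clock. *help_thread(i, j).* Read the pending result (its tag) and the stored parent era, publish that era in the helper's first special reservation, read $ptr$, and leave if the tag of reservation $(i,j)$ is not the tag that was read. Otherwise repeat, while the request is pending: publish the last read clock value in the second special reservation, load $*ptr$, and if the clock is unchanged try to install (pointer, era) as the result by a wide CAS and stop; if this succeeds, install (era, tag$+1$) in reservation $(i,j)$ by wide CAS, as long as its tag is unchanged. At the end both special reservations are reset. *cleanup()*, called at arbitrary times by $\mathit{retire}()$. For each block $b$ in the thread's retire list it reads one by one first the second special reservations of all threads, then all normal reservations, then the first special reservations of all threads. It reclaims $b$ if no era $e$ that it read satisfies $b.\mathit{alloc\_era}\le e\le b.\mathit{retire\_era}$. *Well-behaved programs.* Between API calls, application code may do anything, subject to the following. It retires only blocks that are allocated and not yet retired. It accesses a block only while the block is not yet retired or while it holds a protected reference to it. A thread holds a protected reference to $b$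 at index $j$ from the moment its $\mathit{get\_protected}$ at index $j$ returns $b$, where $b$ was allocated and not yet retired when the returned pointer was loaded, until it calls $\mathit{get\_protected}$ at index $j$ again or $\mathit{clear}()$. When it calls $\mathit{get\_protected}(ptr,\mathit{index},\mathit{parent})$, either $ptr$ is a top-level variable and $\mathit{parent}$ is null, or $ptr$ lies inside the block $\mathit{parent}$, to which the thread holds a protected reference at another index. Then in every state reachable from an initial state (no block allocated, nothing reserved or requested) by any interleaving: 1. If the next step of a thread in $\mathit{cleanup}()$ reclaims a block $b$, then $b$ is retired (in particular it is not reclaimed twice), and no thread may still access $b$: no continuation of the execution in which $b$ is not reclaimed contains an access to $b$, by application code or by the scheme itself. 2. No step, of application code or of the scheme, accesses a block that is reclaimed (or not allocated). 3. The following blocks are not reclaimed: a parent block from which $\mathit{help\_thread}()$ reads (after its tag check and until it resets its second special reservation); a block that a helper has produced as the result of a slow-path request and that was not retired when loaded, until the requesting $\mathit{get\_protected}()$ returns; and a block to which some thread holds a protected reference. -/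

import Mathlib

/-!
A sequentially consistent interleaving model of the Wait-Free Eras (WFE) memory reclamation scheme,
run by `n` threads with `m` (`max_hes`) application reservations each, under the most general
well-behaved client.  Blocks have addresses in `β`; freed addresses may be allocated again.
Every step of the model performs at most one atomic access to memory shared between threads.
-/

namespace WFE

open Function

/-- Indices of the reservations of one thread: the `max_hes` normal ones (`0 .. max_hes-1`), the
first special one (`max_hes`) and the second special one (`max_hes+1`). -/
inductive Slot (m : ℕ) where
  | normal (j : Fin m)
  | special1
  | special2
  deriving DecidableEq

/-- A memory location that holds a hazardous reference: a top-level variable, or a field of a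
block. -/
inductive Loc (β : Type*) where
  | root (r : ℕ)
  | field (b : β) (f : ℕ)
  deriving DecidableEq

/-- Life cycle of a block: `free` (never allocated, or reclaimed), `fresh` (inside `alloc_block()`,
before its `alloc_era` is set), `live` (returned by `alloc_block()`), `retired` (from the call of
`retire()` on). -/
inductive Status where
  | free
  | fresh
  | live
  | retired
  deriving DecidableEq

/-- A pointer loaded from a hazardous location (`none` is `nullptr`).  The bit `valid` is history
information that no code tests: it records whether, at the moment of the load, the pointer
referred to a block that was live, that is, allocated and not yet retired.  A program that unlinks
blocks before it retires them uses this to know which loaded pointers it may follow; a pointer to a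
block that was already retired when it was loaded is never followed by a well-behaved program. -/
structure Loaded (β : Type*) where
  val : Option β
  valid : Bool

/-- The reference that the application obtains when a loaded pointer is returned to it. -/
def Loaded.ref {β : Type*} (r : Loaded β) : Option β := if r.valid then r.val else none

/-- The `result` pair of a slow-path state.  `pending tag` is the pair `(invptr, tag)`, and
`done p era` is a pair `(p, era)` with `p ≠ invptr`. -/
inductive Result (β : Type*) where
  | pending (tag : ℕ)
  | done (p : Loaded β) (era : ℕ∞)

/-- Arguments of `get_protected(ptr, index, parent)`. -/
structure GPArgs (m : ℕ) (β : Type*) where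
  ptr : Loc β
  index : Fin m
  parent : Option β

/-- Which operation called `increment_era()`. -/
inductive Caller where
  | alloc
  | retire

/-- Context of a call `help_thread(i, j)`: the caller of `increment_era()`, the entries that the
loop of `increment_era()` still has to visit after this call, and the arguments. -/
structure HelpCtx (n m : ℕ) where
  caller : Caller
  rest : List (Fin n × Fin m)
  i : Fin n
  j : Fin m

/-- Control points of a thread, with its local variables.  `idle` means that the thread runs
application code. -/
inductive PC (n m : ℕ) (β : Type*) where
  | idle
  -- get_protected(), fast path
  | gpInit (a : GPArgs m β)
  | gpFast (a : GPArgs m β) (prev : ℕ∞)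
  | gpFastCheck (a : GPArgs m β) (prev : ℕ∞) (ret : Loaded β)
  | gpFastPublish (a : GPArgs m β) (new : ℕ)
  -- get_protected(), slow path: announcing the request
  | gpParent (a : GPArgs m β) (prev : ℕ∞)
  | gpStart (a : GPArgs m β) (prev era : ℕ∞)
  | gpSetPtr (a : GPArgs m β) (prev era : ℕ∞)
  | gpSetEra (a : GPArgs m β) (prev era : ℕ∞)
  | gpGetTag (a : GPArgs m β) (prev : ℕ∞)
  | gpRequest (a : GPArgs m β) (prev : ℕ∞) (tag : ℕ)
  -- get_protected(), slow path: the loop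
  | gpLoad (a : GPArgs m β) (prev : ℕ∞) (tag : ℕ)
  | gpCheck (a : GPArgs m β) (prev : ℕ∞) (tag : ℕ) (ret : Loaded β)
  | gpCancel (a : GPArgs m β) (prev : ℕ∞) (tag : ℕ) (ret : Loaded β) (new : ℕ)
  | gpCancelTag (a : GPArgs m β) (tag : ℕ) (ret : Loaded β)
  | gpUpdate (a : GPArgs m β) (prev : ℕ∞) (tag : ℕ) (new : ℕ)
  | gpPoll (a : GPArgs m β) (prev : ℕ∞) (tag : ℕ)
  -- get_protected(), slow path: taking over the result of a helper
  | gpResEra (a : GPArgs m β) (tag : ℕ) (ret : Loaded β)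
  | gpSetRes (a : GPArgs m β) (tag : ℕ) (ret : Loaded β) (era : ℕ∞)
  | gpSetTag (a : GPArgs m β) (tag : ℕ) (ret : Loaded β)
  | gpEnd (a : GPArgs m β) (ret : Loaded β)
  -- increment_era()
  | ieReadEnd (c : Caller)
  | ieReadStart (c : Caller) (ce : ℕ)
  | ieScan (c : Caller) (rest : List (Fin n × Fin m))
  -- help_thread(i, j)
  | hRes (h : HelpCtx n m)
  | hEra (h : HelpCtx n m) (tag : ℕ)
  | hPub1 (h : HelpCtx n m) (tag : ℕ) (era : ℕ∞)
  | hPtr (h : HelpCtx n m) (tag : ℕ)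
  | hTag (h : HelpCtx n m) (tag : ℕ) (ptr : Loc β)
  | hGlobal (h : HelpCtx n m) (tag : ℕ) (ptr : Loc β)
  | hPub2 (h : HelpCtx n m) (tag : ℕ) (ptr : Loc β) (prev : ℕ)
  | hLoad (h : HelpCtx n m) (tag : ℕ) (ptr : Loc β) (prev : ℕ)
  | hCheck (h : HelpCtx n m) (tag : ℕ) (ptr : Loc β) (prev : ℕ) (ret : Loaded β)
  | hCas (h : HelpCtx n m) (tag : ℕ) (ptr : Loc β) (era : ℕ) (ret : Loaded β)
  | hResv (h : HelpCtx n m) (tag : ℕ) (ptr : Loc β) (era : ℕ)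
  | hResvCas (h : HelpCtx n m) (tag : ℕ) (ptr : Loc β) (era : ℕ) (old : ℕ∞ × ℕ)
  | hTest (h : HelpCtx n m) (tag : ℕ) (ptr : Loc β) (prev : ℕ)
  | hClear2 (h : HelpCtx n m) (ptr : Loc β)
  | hClear1 (h : HelpCtx n m)
  -- alloc_block()
  | alMalloc
  | alStamp (b : β)
  -- retire()
  | rtStamp (b : β)
  | rtList
  -- cleanup()
  | clNext (todo : List β)
  | clScan (b : β) (todo : List β) (rest : List (Fin n × Slot m))
  -- clear()
  | clrNext (rest : List (Fin m))

/-- Global states.  `res t s` is the pair `reservations[t][s]` of an era (`⊤` is `∞`) and a tag;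
`stPtr`, `stEra`, `stRes` are the fields `pointer`, `era`, `result` of `state[t][j]`.
The field `refs` is not part of the scheme: `refs t j = some b` means that the application code of
thread `t` holds a reference to `b` protected at index `j`. -/
structure State (n m : ℕ) (β : Type*) where
  globalEra : ℕ
  counterStart : ℕ
  counterEnd : ℕ
  res : Fin n → Slot m → ℕ∞ × ℕ
  stPtr : Fin n → Fin m → Loc β
  stEra : Fin n → Fin m → ℕ∞
  stRes : Fin n → Fin m → Result β
  mem : Loc β → Option β
  status : β → Status
  allocEra : β → ℕ
  retireEra : β → ℕ
  retireList : Fin n → List β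
  pc : Fin n → PC n m β
  refs : Fin n → Fin m → Option β

variable {n m : ℕ} {β : Type*} [DecidableEq β]

/-- What a step does to blocks: it accesses the memory of a block, reclaims a block, or neither. -/
inductive Act (β : Type*) where
  | tau
  | touch (b : β)
  | free (b : β)

/-- Accessing a location accesses the block that contains it, if any. -/
def Loc.act {β : Type*} : Loc β → Act β
  | .root _ => .tau
  | .field b _ => .touch b

namespace State

/-- Thread `t` moves to control point `p`. -/
def goto (σ : State n m β) (t : Fin n) (p : PC n m β) : State n m β :=
  { σ with pc := update σ.pc t p }

/-- Write the whole pair `reservations[i][s]`. -/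
def setRes (σ : State n m β) (i : Fin n) (s : Slot m) (v : ℕ∞ × ℕ) : State n m β :=
  { σ with res := update σ.res i (update (σ.res i) s v) }

/-- Write the era component of `reservations[i][s]`. -/
def setResEra (σ : State n m β) (i : Fin n) (s : Slot m) (e : ℕ∞) : State n m β :=
  σ.setRes i s (e, (σ.res i s).2)

/-- Write the tag component of `reservations[i][s]`. -/
def setResTag (σ : State n m β) (i : Fin n) (s : Slot m) (k : ℕ) : State n m β :=
  σ.setRes i s ((σ.res i s).1, k)

/-- Write `state[i][j].result`. -/
def setStRes (σ : State n m β) (i : Fin n) (j : Fin m) (r : Result β) : State n m β :=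
  { σ with stRes := update σ.stRes i (update (σ.stRes i) j r) }

/-- Write the reference that the application code of thread `t` holds at index `j`. -/
def setRef (σ : State n m β) (t : Fin n) (j : Fin m) (r : Option β) : State n m β :=
  { σ with refs := update σ.refs t (update (σ.refs t) j r) }

def setStatus (σ : State n m β) (b : β) (s : Status) : State n m β :=
  { σ with status := update σ.status b s }

/-- Load the pointer stored at `l`. -/
def load (σ : State n m β) (l : Loc β) : Loaded β where
  val := σ.mem l
  valid := match σ.mem l with
    | some b => decide (σ.status b = .live)
    | none => false

/-- `get_protected` with arguments `a` returns `ret` to the application code of thread `t`. -/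
def gpReturn (σ : State n m β) (t : Fin n) (a : GPArgs m β) (ret : Loaded β) : State n m β :=
  (σ.setRef t a.index ret.ref).goto t .idle

end State

/-- The era `e` (if not `∞`) lies in the lifespan of the retired block `b`. -/
def Covers (σ : State n m β) (e : ℕ∞) (b : β) : Prop :=
  (σ.allocEra b : ℕ∞) ≤ e ∧ e ≤ (σ.retireEra b : ℕ∞)

/-- The order in which `cleanup()` checks the reservations against one block: the second special
reservations of all threads, then all normal reservations, then the first special ones. -/
def scanOrder (n m : ℕ) : List (Fin n × Slot m) :=
  (List.finRange n).map (fun i => (i, Slot.special2)) ++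
  (List.finRange n).flatMap (fun i => (List.finRange m).map fun j => (i, Slot.normal j)) ++
  (List.finRange n).map (fun i => (i, Slot.special1))

/-- The entries `state[i][j]` that `increment_era()` visits, in order. -/
def helpOrder (n m : ℕ) : List (Fin n × Fin m) :=
  (List.finRange n).flatMap fun i => (List.finRange m).map fun j => (i, j)

/-- Where a thread continues when `increment_era()` has returned. -/
def Caller.cont : Caller → List β → PC n m β
  | .alloc, _ => .alMalloc
  | .retire, l => .clNext l

/-- Blocks that application code of thread `t` may access: those that are not retired yet, and
those to which it holds a protected reference. -/
def ClientMay (σ : State n m β) (t : Fin n) (b : β) : Prop :=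
  σ.status b = .live ∨ ∃ j, σ.refs t j = some b

/-- The `parent` argument is correct: `nullptr` for top-level references, and otherwise the block
that contains `ptr`, to which the thread holds a reference protected at another index. -/
def ParentOk (σ : State n m β) (t : Fin n) (a : GPArgs m β) : Prop :=
  match a.ptr with
  | .root _ => a.parent = none
  | .field b _ => a.parent = some b ∧ ∃ j, j ≠ a.index ∧ σ.refs t j = some b

/-- `Step σ t x σ'`: thread `t` performs one step with block action `x`. -/
inductive Step : State n m β → Fin n → Act β → State n m β → Prop
  /- Application code: arbitrary accesses to, and writes through, permitted blocks. -/
  | access {σ t b} : σ.pc t = .idle → ClientMay σ t b → Step σ t (.touch b) σ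
  | write {σ t} {l : Loc β} {v : Option β} : σ.pc t = .idle →
      (∀ b f, l = .field b f → ClientMay σ t b) →
      Step σ t l.act { σ with mem := update σ.mem l v }
  /- Calls of API functions.  A reference held at an index ends when the index is used again or
  cleared; a block is retired at most once per allocation. -/
  | callGetProtected {σ t} {a : GPArgs m β} : σ.pc t = .idle → ParentOk σ t a →
      Step σ t .tau ((σ.setRef t a.index none).goto t (.gpInit a))
  | callClear {σ t} : σ.pc t = .idle →
      Step σ t .tau
        ({ σ with refs := update σ.refs t (fun _ => none) }.goto t (.clrNext (List.finRange m)))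
  | callRetire {σ t b} : σ.pc t = .idle → σ.status b = .live →
      Step σ t .tau ((σ.setStatus b .retired).goto t (.rtStamp b))
  /- `alloc_block()` periodically calls `increment_era()`: any choice is possible. -/
  | callAlloc {σ t} : σ.pc t = .idle → Step σ t .tau (σ.goto t .alMalloc)
  | callAllocInc {σ t} : σ.pc t = .idle → Step σ t .tau (σ.goto t (.ieReadEnd .alloc))
  /- `get_protected()`, fast path.  The number of attempts is arbitrary. -/
  | gpInit {σ t a} : σ.pc t = .gpInit a →
      Step σ t .tau (σ.goto t (.gpFast a (σ.res t (.normal a.index)).1))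
  | gpFastLoad {σ t a prev} : σ.pc t = .gpFast a prev →
      Step σ t a.ptr.act (σ.goto t (.gpFastCheck a prev (σ.load a.ptr)))
  | gpFastReturn {σ t a prev ret} : σ.pc t = .gpFastCheck a prev ret →
      prev = (σ.globalEra : ℕ∞) → Step σ t .tau (σ.gpReturn t a ret)
  | gpFastRetry {σ t a prev ret} : σ.pc t = .gpFastCheck a prev ret →
      prev ≠ (σ.globalEra : ℕ∞) → Step σ t .tau (σ.goto t (.gpFastPublish a σ.globalEra))
  | gpFastPublish {σ t a} {new : ℕ} : σ.pc t = .gpFastPublish a new →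
      Step σ t .tau ((σ.setResEra t (.normal a.index) (new : ℕ∞)).goto t (.gpFast a (new : ℕ∞)))
  | gpGiveUp {σ t a prev} : σ.pc t = .gpFast a prev →
      Step σ t .tau (σ.goto t (.gpParent a prev))
  /- `get_protected()`, slow path: announcing the request. -/
  | gpParentNull {σ t a prev} : σ.pc t = .gpParent a prev → a.parent = none →
      Step σ t .tau (σ.goto t (.gpStart a prev ⊤))
  | gpParentEra {σ t a prev b} : σ.pc t = .gpParent a prev → a.parent = some b →
      Step σ t (.touch b) (σ.goto t (.gpStart a prev (σ.allocEra b : ℕ∞)))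
  | gpStart {σ t a prev era} : σ.pc t = .gpStart a prev era →
      Step σ t .tau
        ({ σ with counterStart := σ.counterStart + 1 }.goto t (.gpSetPtr a prev era))
  | gpSetPtr {σ t a prev era} : σ.pc t = .gpSetPtr a prev era →
      Step σ t .tau
        ({ σ with stPtr := update σ.stPtr t (update (σ.stPtr t) a.index a.ptr) }.goto t
          (.gpSetEra a prev era))
  | gpSetEra {σ t a prev era} : σ.pc t = .gpSetEra a prev era →
      Step σ t .tau
        ({ σ with stEra := update σ.stEra t (update (σ.stEra t) a.index era) }.goto t
          (.gpGetTag a prev))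
  | gpGetTag {σ t a prev} : σ.pc t = .gpGetTag a prev →
      Step σ t .tau (σ.goto t (.gpRequest a prev (σ.res t (.normal a.index)).2))
  | gpRequest {σ t a prev tag} : σ.pc t = .gpRequest a prev tag →
      Step σ t .tau ((σ.setStRes t a.index (.pending tag)).goto t (.gpLoad a prev tag))
  /- `get_protected()`, slow path: the loop. -/
  | gpLoad {σ t a prev tag} : σ.pc t = .gpLoad a prev tag →
      Step σ t a.ptr.act (σ.goto t (.gpCheck a prev tag (σ.load a.ptr)))
  | gpCheckEq {σ t a prev tag ret} : σ.pc t = .gpCheck a prev tag ret →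
      prev = (σ.globalEra : ℕ∞) →
      Step σ t .tau (σ.goto t (.gpCancel a prev tag ret σ.globalEra))
  | gpCheckNe {σ t a prev tag ret} : σ.pc t = .gpCheck a prev tag ret →
      prev ≠ (σ.globalEra : ℕ∞) →
      Step σ t .tau (σ.goto t (.gpUpdate a prev tag σ.globalEra))
  | gpCancelOk {σ t a prev tag ret new} : σ.pc t = .gpCancel a prev tag ret new →
      σ.stRes t a.index = .pending tag →
      Step σ t .tau
        ((σ.setStRes t a.index (.done ⟨none, false⟩ ⊤)).goto t (.gpCancelTag a tag ret))
  | gpCancelFail {σ t a prev tag ret new} : σ.pc t = .gpCancel a prev tag ret new →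
      σ.stRes t a.index ≠ .pending tag →
      Step σ t .tau (σ.goto t (.gpUpdate a prev tag new))
  | gpCancelTag {σ t a tag ret} : σ.pc t = .gpCancelTag a tag ret →
      Step σ t .tau ((σ.setResTag t (.normal a.index) (tag + 1)).goto t (.gpEnd a ret))
  | gpUpdateOk {σ t a prev tag} {new : ℕ} : σ.pc t = .gpUpdate a prev tag new →
      σ.res t (.normal a.index) = (prev, tag) →
      Step σ t .tau
        ((σ.setRes t (.normal a.index) ((new : ℕ∞), tag)).goto t (.gpPoll a (new : ℕ∞) tag))
  | gpUpdateFail {σ t a prev tag} {new : ℕ} : σ.pc t = .gpUpdate a prev tag new →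
      σ.res t (.normal a.index) ≠ (prev, tag) →
      Step σ t .tau (σ.goto t (.gpPoll a (new : ℕ∞) tag))
  | gpPollWait {σ t a prev tag k} : σ.pc t = .gpPoll a prev tag →
      σ.stRes t a.index = .pending k → Step σ t .tau (σ.goto t (.gpLoad a prev tag))
  | gpPollDone {σ t a prev tag p e} : σ.pc t = .gpPoll a prev tag →
      σ.stRes t a.index = .done p e → Step σ t .tau (σ.goto t (.gpResEra a tag p))
  /- `get_protected()`, slow path: taking over the result of a helper. -/
  | gpResEra {σ t a tag ret p e} : σ.pc t = .gpResEra a tag ret →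
      σ.stRes t a.index = .done p e → Step σ t .tau (σ.goto t (.gpSetRes a tag ret e))
  | gpSetRes {σ t a tag ret era} : σ.pc t = .gpSetRes a tag ret era →
      Step σ t .tau ((σ.setResEra t (.normal a.index) era).goto t (.gpSetTag a tag ret))
  | gpSetTag {σ t a tag ret} : σ.pc t = .gpSetTag a tag ret →
      Step σ t .tau ((σ.setResTag t (.normal a.index) (tag + 1)).goto t (.gpEnd a ret))
  | gpEnd {σ t a ret} : σ.pc t = .gpEnd a ret →
      Step σ t .tau ({ σ with counterEnd := σ.counterEnd + 1 }.gpReturn t a ret)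
  /- `increment_era()` -/
  | ieReadEnd {σ t c} : σ.pc t = .ieReadEnd c →
      Step σ t .tau (σ.goto t (.ieReadStart c σ.counterEnd))
  | ieReadStartEq {σ t c ce} : σ.pc t = .ieReadStart c ce → σ.counterStart = ce →
      Step σ t .tau (σ.goto t (.ieScan c []))
  | ieReadStartNe {σ t c ce} : σ.pc t = .ieReadStart c ce → σ.counterStart ≠ ce →
      Step σ t .tau (σ.goto t (.ieScan c (helpOrder n m)))
  | ieScanHelp {σ t c rest i j k} : σ.pc t = .ieScan c ((i, j) :: rest) →
      σ.stRes i j = .pending k → Step σ t .tau (σ.goto t (.hRes ⟨c, rest, i, j⟩))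
  | ieScanSkip {σ t c rest i j p e} : σ.pc t = .ieScan c ((i, j) :: rest) →
      σ.stRes i j = .done p e → Step σ t .tau (σ.goto t (.ieScan c rest))
  | ieIncrement {σ t c} : σ.pc t = .ieScan c [] →
      Step σ t .tau
        ({ σ with globalEra := σ.globalEra + 1 }.goto t (c.cont (σ.retireList t)))
  /- `help_thread(i, j)`: reading the request, reserving the parent, checking the tag. -/
  | hResPending {σ t h k} : σ.pc t = .hRes h → σ.stRes h.i h.j = .pending k →
      Step σ t .tau (σ.goto t (.hEra h k))
  | hResDone {σ t h p e} : σ.pc t = .hRes h → σ.stRes h.i h.j = .done p e →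
      Step σ t .tau (σ.goto t (.ieScan h.caller h.rest))
  | hEra {σ t h tag} : σ.pc t = .hEra h tag →
      Step σ t .tau (σ.goto t (.hPub1 h tag (σ.stEra h.i h.j)))
  | hPub1 {σ t h tag era} : σ.pc t = .hPub1 h tag era →
      Step σ t .tau ((σ.setResEra t .special1 era).goto t (.hPtr h tag))
  | hPtr {σ t h tag} : σ.pc t = .hPtr h tag →
      Step σ t .tau (σ.goto t (.hTag h tag (σ.stPtr h.i h.j)))
  | hTagEq {σ t h tag ptr} : σ.pc t = .hTag h tag ptr →
      (σ.res h.i (.normal h.j)).2 = tag → Step σ t .tau (σ.goto t (.hGlobal h tag ptr))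
  | hTagNe {σ t h tag ptr} : σ.pc t = .hTag h tag ptr →
      (σ.res h.i (.normal h.j)).2 ≠ tag → Step σ t .tau (σ.goto t (.hClear1 h))
  /- `help_thread(i, j)`: the loop. -/
  | hGlobal {σ t h tag ptr} : σ.pc t = .hGlobal h tag ptr →
      Step σ t .tau (σ.goto t (.hPub2 h tag ptr σ.globalEra))
  | hPub2 {σ t h tag ptr} {prev : ℕ} : σ.pc t = .hPub2 h tag ptr prev →
      Step σ t .tau ((σ.setResEra t .special2 (prev : ℕ∞)).goto t (.hLoad h tag ptr prev))
  | hLoad {σ t h tag ptr prev} : σ.pc t = .hLoad h tag ptr prev →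
      Step σ t ptr.act (σ.goto t (.hCheck h tag ptr prev (σ.load ptr)))
  | hCheckEq {σ t h tag ptr prev ret} : σ.pc t = .hCheck h tag ptr prev ret →
      prev = σ.globalEra → Step σ t .tau (σ.goto t (.hCas h tag ptr prev ret))
  | hCheckNe {σ t h tag ptr prev ret} : σ.pc t = .hCheck h tag ptr prev ret →
      prev ≠ σ.globalEra → Step σ t .tau (σ.goto t (.hTest h tag ptr σ.globalEra))
  | hTestAgain {σ t h tag ptr prev} : σ.pc t = .hTest h tag ptr prev →
      σ.stRes h.i h.j = .pending tag → Step σ t .tau (σ.goto t (.hPub2 h tag ptr prev))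
  | hTestExit {σ t h tag ptr prev} : σ.pc t = .hTest h tag ptr prev →
      σ.stRes h.i h.j ≠ .pending tag → Step σ t .tau (σ.goto t (.hClear2 h ptr))
  /- `help_thread(i, j)`: producing the output and handing over the reservation. -/
  | hCasOk {σ t h tag ptr} {era : ℕ} {ret} : σ.pc t = .hCas h tag ptr era ret →
      σ.stRes h.i h.j = .pending tag →
      Step σ t .tau
        ((σ.setStRes h.i h.j (.done ret (era : ℕ∞))).goto t (.hResv h tag ptr era))
  | hCasFail {σ t h tag ptr era ret} : σ.pc t = .hCas h tag ptr era ret →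
      σ.stRes h.i h.j ≠ .pending tag → Step σ t .tau (σ.goto t (.hClear2 h ptr))
  | hResvRead {σ t h tag ptr era} : σ.pc t = .hResv h tag ptr era →
      (σ.res h.i (.normal h.j)).2 = tag →
      Step σ t .tau (σ.goto t (.hResvCas h tag ptr era (σ.res h.i (.normal h.j))))
  | hResvExit {σ t h tag ptr era} : σ.pc t = .hResv h tag ptr era →
      (σ.res h.i (.normal h.j)).2 ≠ tag → Step σ t .tau (σ.goto t (.hClear2 h ptr))
  | hResvCasOk {σ t h tag ptr} {era : ℕ} {old} : σ.pc t = .hResvCas h tag ptr era old →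
      σ.res h.i (.normal h.j) = old →
      Step σ t .tau
        ((σ.setRes h.i (.normal h.j) ((era : ℕ∞), tag + 1)).goto t (.hClear2 h ptr))
  | hResvCasFail {σ t h tag ptr era old} : σ.pc t = .hResvCas h tag ptr era old →
      σ.res h.i (.normal h.j) ≠ old → Step σ t .tau (σ.goto t (.hResv h tag ptr era))
  /- `help_thread(i, j)`: resetting the special reservations. -/
  | hClear2 {σ t h ptr} : σ.pc t = .hClear2 h ptr →
      Step σ t .tau ((σ.setResEra t .special2 ⊤).goto t (.hClear1 h))
  | hClear1 {σ t h} : σ.pc t = .hClear1 h →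
      Step σ t .tau ((σ.setResEra t .special1 ⊤).goto t (.ieScan h.caller h.rest))
  /- `alloc_block()`: any free address may be allocated. -/
  | alMalloc {σ t b} : σ.pc t = .alMalloc → σ.status b = .free →
      Step σ t .tau ((σ.setStatus b .fresh).goto t (.alStamp b))
  | alStamp {σ t b} : σ.pc t = .alStamp b →
      Step σ t (.touch b)
        (({ σ with allocEra := update σ.allocEra b σ.globalEra }.setStatus b .live).goto t .idle)
  /- `retire()`: it periodically calls `cleanup()`, possibly after `increment_era()`. -/
  | rtStamp {σ t b} : σ.pc t = .rtStamp b →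
      Step σ t (.touch b)
        ({ σ with
            retireEra := update σ.retireEra b σ.globalEra
            retireList := update σ.retireList t (σ.retireList t ++ [b]) }.goto t .rtList)
  | rtReturn {σ t} : σ.pc t = .rtList → Step σ t .tau (σ.goto t .idle)
  | rtCleanup {σ t} : σ.pc t = .rtList → Step σ t .tau (σ.goto t (.clNext (σ.retireList t)))
  | rtIncrement {σ t} : σ.pc t = .rtList → Step σ t .tau (σ.goto t (.ieReadEnd .retire))
  /- `cleanup()`: a block of the retire list is reclaimed if no reservation read by the scan lies
  in its lifespan. -/
  | clReturn {σ t} : σ.pc t = .clNext [] → Step σ t .tau (σ.goto t .idle)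
  | clBegin {σ t b todo} : σ.pc t = .clNext (b :: todo) →
      Step σ t .tau (σ.goto t (.clScan b todo (scanOrder n m)))
  | clKeep {σ t b todo i s rest} : σ.pc t = .clScan b todo ((i, s) :: rest) →
      Covers σ (σ.res i s).1 b → Step σ t (.touch b) (σ.goto t (.clNext todo))
  | clPass {σ t b todo i s rest} : σ.pc t = .clScan b todo ((i, s) :: rest) →
      ¬ Covers σ (σ.res i s).1 b → Step σ t (.touch b) (σ.goto t (.clScan b todo rest))
  | clFree {σ t b todo} : σ.pc t = .clScan b todo [] →
      Step σ t (.free b)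
        (({ σ with retireList := update σ.retireList t ((σ.retireList t).erase b) }.setStatus
          b .free).goto t (.clNext todo))
  /- `clear()` -/
  | clrStep {σ t j rest} : σ.pc t = .clrNext (j :: rest) →
      Step σ t .tau ((σ.setResEra t (.normal j) ⊤).goto t (.clrNext rest))
  | clrReturn {σ t} : σ.pc t = .clrNext [] → Step σ t .tau (σ.goto t .idle)

/-- Initial states: nothing is allocated, retired, reserved or requested.  Contents of memory and
the initial era are arbitrary. -/
structure Initial (σ : State n m β) : Prop where
  counterStart : σ.counterStart = 0
  counterEnd : σ.counterEnd = 0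
  res : ∀ t s, σ.res t s = (⊤, 0)
  stRes : ∀ t j, σ.stRes t j = .done ⟨none, false⟩ ⊤
  status : ∀ b, σ.status b = .free
  retireList : ∀ t, σ.retireList t = []
  pc : ∀ t, σ.pc t = .idle
  refs : ∀ t j, σ.refs t j = none

/-- States that occur in some execution. -/
def Reachable (σ : State n m β) : Prop :=
  ∃ σ₀, Initial σ₀ ∧ Relation.ReflTransGen (fun τ τ' => ∃ t x, Step τ t x τ') σ₀ σ

/-- In state `σ`, thread `u` may still access `b`: some continuation of the execution in which `b`
is not reclaimed leads to a step of `u` that accesses `b`. -/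
def MayStillAccess (σ : State n m β) (u : Fin n) (b : β) : Prop :=
  ∃ τ τ', Relation.ReflTransGen (fun ρ ρ' => ∃ t x, x ≠ .free b ∧ Step ρ t x ρ') σ τ ∧
    Step τ u (.touch b) τ'

/-- The location `ptr` that a thread inside `help_thread()` works on, from the successful tag check
until it resets its second special reservation. -/
def PC.helping : PC n m β → Option (Loc β)
  | .hGlobal _ _ ptr => some ptr
  | .hPub2 _ _ ptr _ => some ptr
  | .hLoad _ _ ptr _ => some ptr
  | .hCheck _ _ ptr _ _ => some ptr
  | .hCas _ _ ptr _ _ => some ptr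
  | .hResv _ _ ptr _ => some ptr
  | .hResvCas _ _ ptr _ _ => some ptr
  | .hTest _ _ ptr _ => some ptr
  | .hClear2 _ ptr => some ptr
  | _ => none

/-- The index for which a thread inside `get_protected()` has made a slow-path request whose
outcome it has not returned yet. -/
def PC.requesting : PC n m β → Option (Fin m)
  | .gpLoad a _ _ => some a.index
  | .gpCheck a _ _ _ => some a.index
  | .gpCancel a _ _ _ _ => some a.index
  | .gpCancelTag a _ _ => some a.index
  | .gpUpdate a _ _ _ => some a.index
  | .gpPoll a _ _ => some a.index
  | .gpResEra a _ _ => some a.index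
  | .gpSetRes a _ _ _ => some a.index
  | .gpSetTag a _ _ => some a.index
  | .gpEnd a _ => some a.index
  | _ => none

/-- `b` is the parent block from which some thread inside `help_thread()` reads. -/
def HelpedParent (σ : State n m β) (b : β) : Prop :=
  ∃ t f, (σ.pc t).helping = some (.field b f)

/-- A helper has produced `b`, which was live when it was loaded, as the output of a slow-path
request that has not returned yet. -/
def HandedOver (σ : State n m β) (b : β) : Prop :=
  ∃ t j e, (σ.pc t).requesting = some j ∧ σ.stRes t j = .done ⟨some b, true⟩ e

/-- Some thread holds a reference to `b` that `get_protected()` has returned. -/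
def Referenced (σ : State n m β) (b : β) : Prop :=
  ∃ t j, σ.refs t j = some b

end WFE

/-!
Safety of reclamation in Wait-Free Eras, by an inductive invariant of the interleaving model.

The central notion is `Guard σ e i s b`: the era `e` lies in the lifespan of the allocated block
`b`, and every scan of `b` by `cleanup()` that is under way still has to read reservation `s` of
thread `i`. As long as that reservation contains `e`, a guard can only be lost by a scan that reads
the reservation, and such a scan keeps the block; hence guards are stable (`Guard.step`) and a
guarded block is not reclaimed. Guards arise at loads: while a block is live, no scan of it is under
way, so any reservation that contains the current clock value guards it (`guard_of_load`). They move
along the scanning order: `cleanup()` reads the second special reservations, then the normal ones,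
then the first special ones, so that a scan which has not yet read a reservation of one kind has not
read any reservation of a later kind (`special2_before_normal`, `normal_before_special1`). This is
what makes the two transfers of the slow path safe: the result of a helper moves from its second
special reservation to the normal reservation of the requester, and the parent moves from a normal
reservation of the requester to the first special reservation of the helper.

A pointer that is loaded under era `e` is used only if the clock still has the value `e` afterwards.
Since the clock is monotone, the invariant can therefore assert the guard under the hypothesis that
the clock is at most `e`.

The slow path is controlled by the tags (`Proto`). A helper that has read the request `(i, j)` with
tag `k` knows that the tag of reservation `(i, j)` is larger than `k`, or that it is `k` and the
request is still being served (`Proto.seen`). In the latter case the stored pointer and era are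
those of the request, and the requester holds a protected reference to the parent; this is what the
tag check of `help_thread()` exploits (`Inv.parent_guard`). The same dichotomy makes every wide CAS
of a belated helper fail, so a reservation is changed by another thread only while its owner waits
for the result (`Proto.cas`). While a result is handed over, its block is guarded by the second
special reservation of the helper as long as the tag is `k`, and by the normal reservation of the
requester from the moment the tag is `k + 1` (`Safe.handover`).

At the end of a scan of `b` the list of reservations still to be read is empty, so no guard of `b`
exists, and the scanning thread can do nothing but reclaim `b`. As every access to a retired block,
apart from those of its retiring thread, comes with a guard (`Inv.touch`), no access to `b` can
follow.
-/

namespace WFE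

open Function

variable {n m : ℕ} {β : Type*}

/-! ### Life cycle of blocks -/

/-- The life cycle of blocks: each block that is being allocated, is being retired or is in a retire
list belongs to a single thread, with the corresponding status. -/
structure Life (σ : State n m β) : Prop where
  /-- A block whose `alloc_era` is not yet set is `fresh`. -/
  allocating : ∀ t b, σ.pc t = .alStamp b → σ.status b = .fresh
  allocating_unique : ∀ t u b, σ.pc t = .alStamp b → σ.pc u = .alStamp b → t = u
  /-- A block whose `retire_era` is not yet set is `retired`. -/
  retiring : ∀ t b, σ.pc t = .rtStamp b → σ.status b = .retired
  retiring_unique : ∀ t u b, σ.pc t = .rtStamp b → σ.pc u = .rtStamp b → t = u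
  /-- A block enters a retire list only when its `retire_era` is set. -/
  retiring_not_mem : ∀ t u b, σ.pc t = .rtStamp b → b ∉ σ.retireList u
  /-- Retire lists contain retired blocks only. -/
  listed : ∀ t b, b ∈ σ.retireList t → σ.status b = .retired
  listed_unique : ∀ t u b, b ∈ σ.retireList t → b ∈ σ.retireList u → t = u
  nodup : ∀ t, (σ.retireList t).Nodup
  /-- The blocks that `cleanup()` still has to treat are distinct members of the retire list. -/
  todo : ∀ t l, σ.pc t = .clNext l → l.Nodup ∧ l ⊆ σ.retireList t
  /-- The same during a scan, for the block being scanned and those after it. -/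
  scan : ∀ t b l r, σ.pc t = .clScan b l r →
    b ∉ l ∧ l.Nodup ∧ b ∈ σ.retireList t ∧ l ⊆ σ.retireList t
  /-- The reservations that a scan still has to read form a final segment of `scanOrder`. -/
  order : ∀ t b l r, σ.pc t = .clScan b l r → r <:+ scanOrder n m
  /-- The `alloc_era` of an allocated block is at most the clock. -/
  alloc_le : ∀ b, σ.status b = .live ∨ σ.status b = .retired → σ.allocEra b ≤ σ.globalEra

theorem Caller.cont_cases (c : Caller) (l : List β) :
    (c.cont l : PC n m β) = .alMalloc ∨ (c.cont l : PC n m β) = .clNext l := by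
  cases c <;> simp [Caller.cont]

section
variable [DecidableEq β]

set_option maxHeartbeats 4000000 in
theorem Life.step {σ σ' : State n m β} {t : Fin n} {x : Act β} (h : Life σ) (hs : Step σ t x σ') :
    Life σ' := by
  constructor
  case allocating | retiring | todo | scan | order =>
    have h_allocating := h.allocating
    have h_retiring := h.retiring
    have h_todo := h.todo
    have h_scan := h.scan
    have h_order := h.order
    have h_allocating_unique := h.allocating_unique
    have h_retiring_unique := h.retiring_unique
    have h_retiring_not_mem := h.retiring_not_mem
    have h_listed := h.listed
    have h_listed_unique := h.listed_unique
    have h_nodup := h.nodup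
    clear h
    cases hs
    all_goals
      try simp only [State.goto, State.setRes, State.setResEra, State.setResTag, State.setStRes,
        State.setRef, State.setStatus, State.gpReturn, update_apply]
      -- If the step leaves the assertion unchanged for all other threads and void for the acting
      -- one, this is checked directly; otherwise the case is left to `grind`.
      first
        | intro w
          by_cases hw : w = t
          · subst hw
            simp only [if_true, reduceCtorEq, false_imp_iff, implies_true]
          · simp only [if_neg hw]
            first | exact h_allocating w | exact h_retiring w | exact h_todo w | exact h_scan w
              | exact h_order w
        | grind [Caller.cont_cases, List.suffix_cons, List.IsSuffix.trans, List.suffix_refl]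
  case listed | listed_unique | nodup | alloc_le =>
    have h_listed := h.listed
    have h_listed_unique := h.listed_unique
    have h_nodup := h.nodup
    have h_alloc_le := h.alloc_le
    have h_allocating := h.allocating
    have h_retiring := h.retiring
    have h_retiring_not_mem := h.retiring_not_mem
    have h_scan := h.scan
    clear h
    cases hs
    all_goals
      try simp only [State.goto, State.setRes, State.setResEra, State.setResTag, State.setStRes,
        State.setRef, State.setStatus, State.gpReturn, update_apply]
      first
        | exact h_listed
        | exact h_listed_unique
        | exact h_nodup
        | exact h_alloc_le
        | grind [Caller.cont_cases]
  case allocating_unique | retiring_unique | retiring_not_mem =>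
    have h_allocating_unique := h.allocating_unique
    have h_retiring_unique := h.retiring_unique
    have h_retiring_not_mem := h.retiring_not_mem
    have h_allocating := h.allocating
    have h_retiring := h.retiring
    have h_listed := h.listed
    clear h
    cases hs
    all_goals
      try simp only [State.goto, State.setRes, State.setResEra, State.setResTag, State.setStRes,
        State.setRef, State.setStatus, State.gpReturn, update_apply]
      grind [Caller.cont_cases]

end

/-! ### Guards -/

/-- Reservation `s` of thread `i`, when it contains the era `e`, protects block `b`: the block is
allocated, `e` lies in its lifespan (whose end is known once the block is in a retire list, and will
be at least the present clock otherwise), and no scan of `b` by `cleanup()` has passed the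
reservation. That the reservation contains `e` is not part of the definition. -/
structure Guard (σ : State n m β) (e : ℕ∞) (i : Fin n) (s : Slot m) (b : β) : Prop where
  alive : σ.status b = .live ∨ σ.status b = .retired
  alloc_le : (σ.allocEra b : ℕ∞) ≤ e
  le_clock : e ≤ (σ.globalEra : ℕ∞)
  le_retire : ∀ t, b ∈ σ.retireList t → e ≤ (σ.retireEra b : ℕ∞)
  scan : ∀ t l r, σ.pc t = .clScan b l r → (i, s) ∈ r

theorem Guard.not_free {σ : State n m β} {e : ℕ∞} {i : Fin n} {s : Slot m} {b : β}
    (h : Guard σ e i s b) : σ.status b ≠ .free := by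
  rcases h.alive with h | h <;> simp [h]

/-- No scan of a live block is under way, so every reservation with the current era guards it. -/
theorem guard_of_load {σ : State n m β} {l : Loc β} {b : β} {e : ℕ∞} (h : Life σ)
    (hb : (σ.load l).ref = some b) (he : e = σ.globalEra) (i : Fin n) (s : Slot m) :
    Guard σ e i s b := by
  have hlive : σ.status b = .live := by
    unfold State.load Loaded.ref at hb
    grind
  subst he
  refine ⟨.inl hlive, by exact_mod_cast h.alloc_le b (.inl hlive), le_rfl, fun t ht => ?_,
    fun t l r hp => ?_⟩
  · simp [h.listed t b ht] at hlive
  · simp [h.listed t b (h.scan t b l r hp).2.2.1] at hlive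

theorem special2_before_normal {r : List (Fin n × Slot m)} (hr : r <:+ scanOrder n m)
    {t i : Fin n} {j : Fin m} (h : (t, Slot.special2) ∈ r) : (i, Slot.normal j) ∈ r := by
  have hr' : r <:+ (List.finRange n).map (fun i => (i, Slot.special2)) ++
      ((List.finRange n).flatMap (fun i => (List.finRange m).map fun j => (i, Slot.normal j)) ++
      (List.finRange n).map (fun i => (i, Slot.special1))) := by
    simpa [scanOrder] using hr
  rcases List.suffix_or_suffix_of_suffix hr' (List.suffix_append _ _) with h' | h'
  · have := h'.subset h
    simp at this
  · apply h'.subset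
    simp

theorem normal_before_special1 {r : List (Fin n × Slot m)} (hr : r <:+ scanOrder n m)
    {t i : Fin n} {j : Fin m} (h : (i, Slot.normal j) ∈ r) : (t, Slot.special1) ∈ r := by
  rcases List.suffix_or_suffix_of_suffix hr (List.suffix_append _ _) with h' | h'
  · have := h'.subset h
    simp at this
  · apply h'.subset
    simp

section
variable [DecidableEq β]

theorem Step.clock_le {σ σ' : State n m β} {t : Fin n} {x : Act β} (hs : Step σ t x σ') :
    σ.globalEra ≤ σ'.globalEra := by
  cases hs <;> first | exact le_rfl | exact Nat.le_succ _

set_option maxHeartbeats 4000000 in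
/-- A guard persists as long as the reservation contains its era before the step: a scan that reads
the reservation finds the era in the lifespan of `b`. The step itself may overwrite the
reservation. -/
theorem Guard.step {σ σ' : State n m β} {t : Fin n} {x : Act β} {e : ℕ∞} {i : Fin n} {s : Slot m}
    {b : β} (hg : Guard σ e i s b) (h : Life σ) (hs : Step σ t x σ') (he : (σ.res i s).1 = e) :
    Guard σ' e i s b := by
  have hc := hs.clock_le
  have h_listed := h.listed
  have h_allocating := h.allocating
  have h_scan := h.scan
  clear h
  obtain ⟨h1, h2, h3, h4, h5⟩ := hg
  constructor
  case le_clock => exact h3.trans (by exact_mod_cast hc)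
  case scan =>
    have h_all : (i, s) ∈ scanOrder n m := by
      cases s <;> simp [scanOrder]
    have h_covers : ∀ t, b ∈ σ.retireList t → Covers σ e b := fun t ht => ⟨h2, h4 t ht⟩
    clear h1 h2 h3 h4
    cases hs
    all_goals
      try simp only [State.goto, State.setRes, State.setResEra, State.setResTag, State.setStRes,
        State.setRef, State.setStatus, State.gpReturn, update_apply]
      first
        | intro w
          by_cases hw : w = t
          · subst hw
            simp only [if_true, reduceCtorEq, false_imp_iff, implies_true]
          · simp only [if_neg hw]
            exact h5 w
        | grind [Caller.cont_cases]
  case alive | alloc_le | le_retire =>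
    cases hs
    all_goals
      try simp only [State.goto, State.setRes, State.setResEra, State.setResTag, State.setStRes,
        State.setRef, State.setStatus, State.gpReturn, update_apply]
      first | exact h1 | exact h2 | exact h4 | grind [Caller.cont_cases, List.mem_of_mem_erase]

end

/-! ### Well-behaved clients and eras -/

/-- The arguments of the call of `get_protected()` that a thread executes. -/
def PC.args : PC n m β → Option (GPArgs m β)
  | .gpInit a | .gpFast a _ | .gpFastCheck a _ _ | .gpFastPublish a _ | .gpParent a _
  | .gpStart a _ _ | .gpSetPtr a _ _ | .gpSetEra a _ _ | .gpGetTag a _ | .gpRequest a _ _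
  | .gpLoad a _ _ | .gpCheck a _ _ _ | .gpCancel a _ _ _ _ | .gpCancelTag a _ _
  | .gpUpdate a _ _ _ | .gpPoll a _ _ | .gpResEra a _ _ | .gpSetRes a _ _ _ | .gpSetTag a _ _
  | .gpEnd a _ => some a
  | _ => none

/-- References of the application: during `get_protected()` the parent argument stays correct and the
index in use holds no reference, and during `clear()` there are no references. -/
structure Client (σ : State n m β) : Prop where
  parent_root : ∀ t a, (σ.pc t).args = some a → ∀ r, a.ptr = .root r → a.parent = none
  parent_field : ∀ t a, (σ.pc t).args = some a → ∀ b f, a.ptr = .field b f →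
    a.parent = some b ∧ ∃ j, j ≠ a.index ∧ σ.refs t j = some b
  unused : ∀ t a, (σ.pc t).args = some a → σ.refs t a.index = none
  cleared : ∀ t r, σ.pc t = .clrNext r → ∀ j, σ.refs t j = none

/-- The era `e` is `∞` or has been a value of the clock. -/
def EraOk (σ : State n m β) (e : ℕ∞) : Prop := e = ⊤ ∨ e ≤ (σ.globalEra : ℕ∞)

/-- The era that a thread holds in a local variable in order to publish it, or has published in its
second special reservation. -/
def PC.clock : PC n m β → Option ℕ∞
  | .gpFastPublish _ e | .gpCancel _ _ _ _ e | .gpUpdate _ _ _ e | .hPub2 _ _ _ e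
  | .hLoad _ _ _ e | .hCheck _ _ _ e _ | .hCas _ _ _ e _ | .hResv _ _ _ e
  | .hResvCas _ _ _ e _ | .hTest _ _ _ e => some (e : ℕ∞)
  | .gpSetRes _ _ _ e => some e
  | _ => none

/-- All finite eras in normal reservations, results and local variables are at most the clock. -/
structure Clock (σ : State n m β) : Prop where
  res : ∀ t j, EraOk σ (σ.res t (.normal j)).1
  stRes : ∀ t j p e, σ.stRes t j = .done p e → EraOk σ e
  pc : ∀ t e, (σ.pc t).clock = some e → EraOk σ e

theorem eraOk_clock (σ : State n m β) : EraOk σ σ.globalEra := .inr le_rfl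

theorem eraOk_top (σ : State n m β) : EraOk σ ⊤ := .inl rfl

theorem parentOk_iff {σ : State n m β} {t : Fin n} {a : GPArgs m β} :
    ParentOk σ t a ↔ (∀ r, a.ptr = .root r → a.parent = none) ∧
      ∀ b f, a.ptr = .field b f → a.parent = some b ∧ ∃ j, j ≠ a.index ∧ σ.refs t j = some b := by
  unfold ParentOk
  cases a.ptr <;> simp

section
variable [DecidableEq β]

set_option maxHeartbeats 4000000 in
theorem Client.step {σ σ' : State n m β} {t : Fin n} {x : Act β} (h : Client σ)
    (hs : Step σ t x σ') : Client σ' := by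
  constructor
  case parent_root | parent_field | unused | cleared =>
    have h_parent_root := h.parent_root
    have h_parent_field := h.parent_field
    have h_unused := h.unused
    have h_cleared := h.cleared
    clear h
    cases hs
    all_goals
      try simp only [State.goto, State.setRes, State.setResEra, State.setResTag, State.setStRes,
        State.setRef, State.setStatus, State.gpReturn, update_apply, ite_apply]
      first
        | intro w
          by_cases hw : w = t
          · subst hw
            simp only [if_true, PC.args, reduceCtorEq, false_imp_iff, implies_true]
          · simp only [if_neg hw]
            first | exact h_parent_root w | exact h_parent_field w | exact h_unused w
              | exact h_cleared w
        | grind [Caller.cont_cases, PC.args, parentOk_iff]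

theorem Step.eraOk {σ σ' : State n m β} {t : Fin n} {x : Act β} (hs : Step σ t x σ') {e : ℕ∞}
    (h : EraOk σ e) : EraOk σ' e :=
  h.imp_right fun h => h.trans (by exact_mod_cast hs.clock_le)

set_option maxHeartbeats 4000000 in
theorem Clock.step {σ σ' : State n m β} {t : Fin n} {x : Act β} (h : Clock σ)
    (hs : Step σ t x σ') : Clock σ' := by
  have h_res := h.res
  have h_stRes := h.stRes
  have h_pc := h.pc
  have h_top := eraOk_top σ
  have h_clock := eraOk_clock σ
  -- All eras after the step were bounded by the clock before it.
  suffices H : (∀ u j, EraOk σ (σ'.res u (.normal j)).1) ∧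
      (∀ u j p e, σ'.stRes u j = .done p e → EraOk σ e) ∧
      ∀ u e, (σ'.pc u).clock = some e → EraOk σ e from
    ⟨fun u j => hs.eraOk (H.1 u j), fun u j p e hr => hs.eraOk (H.2.1 u j p e hr),
      fun u e he => hs.eraOk (H.2.2 u e he)⟩
  clear h
  refine ⟨?_, ?_, ?_⟩
  all_goals
    cases hs
    all_goals
      try simp only [State.goto, State.setRes, State.setResEra, State.setResTag, State.setStRes,
        State.setRef, State.setStatus, State.gpReturn, update_apply]
      first
        | exact h_res
        | exact h_stRes
        | intro w
          by_cases hw : w = t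
          · subst hw
            simp only [if_true, PC.clock, reduceCtorEq, false_imp_iff, implies_true]
          · simp only [if_neg hw]
            exact h_pc w
        | grind [Caller.cont_cases, PC.clock]

end

/-! ### Requests, tags and results -/

/-- Control points of `get_protected()` outside the slow-path loop at which the normal reservation
contains the era `prev_era`, with the arguments and this era. -/
def PC.tracking : PC n m β → Option (GPArgs m β × ℕ∞)
  | .gpFast a e | .gpFastCheck a e _ | .gpParent a e | .gpStart a e _ | .gpSetPtr a e _
  | .gpSetEra a e _ | .gpGetTag a e | .gpRequest a e _ => some (a, e)
  | _ => none

/-- Control points of the slow-path loop, with the arguments, `prev_era` and the tag. -/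
def PC.looping : PC n m β → Option (GPArgs m β × ℕ∞ × ℕ)
  | .gpLoad a e k | .gpCheck a e k _ | .gpCancel a e k _ _ | .gpUpdate a e k _
  | .gpPoll a e k => some (a, e, k)
  | _ => none

/-- The index and the tag of the request at the control points of the slow-path loop. -/
def PC.loopReq : PC n m β → Option (Fin m × ℕ)
  | .gpLoad a _ k | .gpCheck a _ k _ | .gpCancel a _ k _ _ | .gpUpdate a _ k _
  | .gpPoll a _ k => some (a.index, k)
  | _ => none

/-- The index and the tag of a request that is being served: from the moment it is made until the
requester increments the tag. -/
def PC.active : PC n m β → Option (Fin m × ℕ)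
  | .gpLoad a _ k | .gpCheck a _ k _ | .gpCancel a _ k _ _ | .gpUpdate a _ k _ | .gpPoll a _ k
  | .gpCancelTag a k _ | .gpResEra a k _ | .gpSetRes a k _ _ | .gpSetTag a k _ =>
    some (a.index, k)
  | _ => none

/-- The arguments, while the pointer stored for the helpers is that of the present call. -/
def PC.announced : PC n m β → Option (GPArgs m β)
  | .gpSetEra a _ _ | .gpGetTag a _ | .gpRequest a _ _
  | .gpLoad a _ _ | .gpCheck a _ _ _ | .gpCancel a _ _ _ _ | .gpUpdate a _ _ _ | .gpPoll a _ _
  | .gpCancelTag a _ _ | .gpResEra a _ _ | .gpSetRes a _ _ _ | .gpSetTag a _ _ => some a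
  | _ => none

/-- The request `(i, j)` and its tag, as read by a helper, at the control points where the tag
still decides what the helper may conclude or do. -/
def PC.seen : PC n m β → Option (Fin n × Fin m × ℕ)
  | .hEra h k | .hPub1 h k _ | .hPtr h k | .hTag h k _ | .hResv h k _ _
  | .hResvCas h k _ _ _ => some (h.i, h.j, k)
  | _ => none

/-- The request `(i, j)`, its tag and the era of the result, while a helper that has produced the
result hands over its reservation. -/
def PC.handing : PC n m β → Option (Fin n × Fin m × ℕ × ℕ∞)
  | .hResv h k _ e | .hResvCas h k _ e _ => some (h.i, h.j, k, (e : ℕ∞))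
  | _ => none

/-- The era in the second special reservation of a helper from the load on. -/
def PC.loadEra : PC n m β → Option ℕ∞
  | .hLoad _ _ _ e | .hCheck _ _ _ e _ | .hCas _ _ _ e _ | .hResv _ _ _ e
  | .hResvCas _ _ _ e _ => some (e : ℕ∞)
  | _ => none

/-- The era of a result, if the request is not pending. -/
def Result.era : Result β → Option ℕ∞
  | .done _ e => some e
  | .pending _ => none

/-- The slow-path protocol. For a request with tag `k`, the tag of the reservation is `k` while the
request is pending. Once there is a result, it is either still `k`, or it is `k + 1` and the
reservation contains the era of the result. -/
structure Proto (σ : State n m β) : Prop where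
  tracking : ∀ t a e, (σ.pc t).tracking = some (a, e) → (σ.res t (.normal a.index)).1 = e
  request : ∀ t a e k, σ.pc t = .gpRequest a e k → (σ.res t (.normal a.index)).2 = k
  looping : ∀ t a e k, (σ.pc t).looping = some (a, e, k) →
    (σ.stRes t a.index = .pending k ∧ σ.res t (.normal a.index) = (e, k)) ∨
    ∃ p e', σ.stRes t a.index = .done p e' ∧ ((σ.res t (.normal a.index)).2 = k ∨
      σ.res t (.normal a.index) = (e', k + 1))
  cancelTag : ∀ t a k r, σ.pc t = .gpCancelTag a k r →
    σ.stRes t a.index = .done ⟨none, false⟩ ⊤ ∧ (σ.res t (.normal a.index)).2 = k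
  resEra : ∀ t a k p, σ.pc t = .gpResEra a k p →
    ∃ e, σ.stRes t a.index = .done p e ∧ ((σ.res t (.normal a.index)).2 = k ∨
      σ.res t (.normal a.index) = (e, k + 1))
  setRes : ∀ t a k p e, σ.pc t = .gpSetRes a k p e →
    σ.stRes t a.index = .done p e ∧ ((σ.res t (.normal a.index)).2 = k ∨
      σ.res t (.normal a.index) = (e, k + 1))
  setTag : ∀ t a k p, σ.pc t = .gpSetTag a k p →
    ∃ e, σ.stRes t a.index = .done p e ∧ (σ.res t (.normal a.index) = (e, k) ∨
      σ.res t (.normal a.index) = (e, k + 1))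
  /-- Only a thread in the slow-path loop has a pending request. -/
  pending : ∀ t j k, σ.stRes t j = .pending k →
    (σ.pc t).loopReq = some (j, k)
  /-- The tag of a request that a helper has read is outdated, or the request is being served. -/
  seen : ∀ t i j k, (σ.pc t).seen = some (i, j, k) → k < (σ.res i (.normal j)).2 ∨
    (k = (σ.res i (.normal j)).2 ∧ (σ.pc i).active = some (j, k))
  /-- As long as the tag is unchanged, the result is the one that the helper has produced. -/
  handing : ∀ t i j k e, (σ.pc t).handing = some (i, j, k, e) → (σ.res i (.normal j)).2 = k →
    (σ.stRes i j).era = some e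
  loadEra : ∀ t e, (σ.pc t).loadEra = some e → (σ.res t .special2).1 = e
  /-- The wide CAS of a helper expects the tag of the request. -/
  casTag : ∀ t h k l e old, σ.pc t = .hResvCas h k l e old → old.2 = k
  announced : ∀ t a, (σ.pc t).announced = some a → σ.stPtr t a.index = a.ptr
  /-- As long as the tag is unchanged, what a helper has read belongs to the request. -/
  pub1 : ∀ t h k e, σ.pc t = .hPub1 h k e → (σ.res h.i (.normal h.j)).2 = k → e = σ.stEra h.i h.j
  ptr : ∀ t h k, σ.pc t = .hPtr h k → (σ.res h.i (.normal h.j)).2 = k →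
    (σ.res t .special1).1 = σ.stEra h.i h.j
  tag : ∀ t h k l, σ.pc t = .hTag h k l → (σ.res h.i (.normal h.j)).2 = k →
    (σ.res t .special1).1 = σ.stEra h.i h.j ∧ l = σ.stPtr h.i h.j

theorem PC.exists_looping {p : PC n m β} {j : Fin m} {k : ℕ} (h : p.loopReq = some (j, k)) :
    ∃ a e, p.looping = some (a, e, k) ∧ a.index = j := by
  cases p <;> simp_all [PC.loopReq, PC.looping]

theorem PC.active_of_looping {p : PC n m β} {a : GPArgs m β} {e : ℕ∞} {k : ℕ}
    (h : p.looping = some (a, e, k)) : p.active = some (a.index, k) := by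
  cases p <;> simp_all [PC.active, PC.looping]

theorem PC.loadEra_of_handing {p : PC n m β} {i : Fin n} {j : Fin m} {k : ℕ} {e : ℕ∞}
    (h : p.handing = some (i, j, k, e)) : p.loadEra = some e := by
  cases p <;> simp_all [PC.handing, PC.loadEra]

theorem PC.active_of_tracking {p : PC n m β} {a : GPArgs m β} {e : ℕ∞}
    (h : p.tracking = some (a, e)) : p.active = none := by
  cases p <;> simp_all [PC.active, PC.tracking]

theorem PC.active_of_loopReq {p : PC n m β} {j : Fin m} {k : ℕ}
    (h : p.loopReq = some (j, k)) : p.active = some (j, k) := by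
  cases p <;> simp_all [PC.active, PC.loopReq]

theorem PC.seen_of_handing {p : PC n m β} {i : Fin n} {j : Fin m} {k : ℕ}
    {e : ℕ∞} (h : p.handing = some (i, j, k, e)) : p.seen = some (i, j, k) := by
  cases p <;> simp_all [PC.handing, PC.seen]

theorem Proto.pending_active {σ : State n m β} (h : Proto σ) (t : Fin n) (j : Fin m) (k : ℕ)
    (hp : σ.stRes t j = .pending k) :
    (σ.pc t).active = some (j, k) ∧ (σ.res t (.normal j)).2 = k := by
  have h1 := h.pending t j k hp
  obtain ⟨a, e, h2, rfl⟩ := PC.exists_looping h1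
  refine ⟨PC.active_of_loopReq h1, ?_⟩
  rcases h.looping t a e k h2 with h3 | ⟨p, e', h3, -⟩
  · rw [h3.2]
  · simp [hp] at h3

/-- A helper changes a reservation only while the corresponding request is being served and has the
result of this helper. -/
theorem Proto.cas {σ : State n m β} (h : Proto σ) (t : Fin n) (c : HelpCtx n m) (k : ℕ)
    (l : Loc β) (e : ℕ) (old : ℕ∞ × ℕ) (hp : σ.pc t = .hResvCas c k l e old)
    (ho : σ.res c.i (.normal c.j) = old) :
    (σ.res c.i (.normal c.j)).2 = k ∧ (σ.pc c.i).active = some (c.j, k) ∧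
      (σ.stRes c.i c.j).era = some (e : ℕ∞) := by
  have h1 := h.casTag t c k l e old hp
  have h2 : (σ.res c.i (.normal c.j)).2 = k := by rw [ho, h1]
  refine ⟨h2, ?_, h.handing t c.i c.j k e (by rw [hp]; rfl) h2⟩
  rcases h.seen t c.i c.j k (by rw [hp]; rfl) with h3 | h3
  · omega
  · exact h3.2

theorem Proto.request_res {σ : State n m β} (h : Proto σ) (t : Fin n) (a : GPArgs m β) (e : ℕ∞)
    (k : ℕ) (hp : σ.pc t = .gpRequest a e k) : σ.res t (.normal a.index) = (e, k) :=
  Prod.ext (h.tracking t a e (by rw [hp]; rfl)) (h.request t a e k hp)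

theorem Proto.poll {σ : State n m β} (h : Proto σ) (t : Fin n) (a : GPArgs m β) (e : ℕ∞)
    (k : ℕ) (p : Loaded β) (e' : ℕ∞) (hp : σ.pc t = .gpPoll a e k)
    (hr : σ.stRes t a.index = .done p e') :
    (σ.res t (.normal a.index)).2 = k ∨ σ.res t (.normal a.index) = (e', k + 1) := by
  have := h.looping t a e k (by rw [hp]; rfl)
  grind

theorem Proto.seen_handing {σ : State n m β} (h : Proto σ) (t i : Fin n) (j : Fin m) (k : ℕ)
    (e : ℕ∞) (hp : (σ.pc t).handing = some (i, j, k, e)) : k < (σ.res i (.normal j)).2 ∨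
    (k = (σ.res i (.normal j)).2 ∧ (σ.pc i).active = some (j, k)) :=
  h.seen t i j k (PC.seen_of_handing hp)

theorem Proto.seen_pub1 {σ : State n m β} (h : Proto σ) (t : Fin n) (c : HelpCtx n m) (k : ℕ)
    (e : ℕ∞) (hp : σ.pc t = .hPub1 c k e) : k < (σ.res c.i (.normal c.j)).2 ∨
    (k = (σ.res c.i (.normal c.j)).2 ∧ (σ.pc c.i).active = some (c.j, k)) :=
  h.seen t c.i c.j k (by rw [hp]; rfl)

theorem Proto.seen_ptr {σ : State n m β} (h : Proto σ) (t : Fin n) (c : HelpCtx n m) (k : ℕ)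
    (hp : σ.pc t = .hPtr c k) : k < (σ.res c.i (.normal c.j)).2 ∨
    (k = (σ.res c.i (.normal c.j)).2 ∧ (σ.pc c.i).active = some (c.j, k)) :=
  h.seen t c.i c.j k (by rw [hp]; rfl)

theorem Proto.seen_tag {σ : State n m β} (h : Proto σ) (t : Fin n) (c : HelpCtx n m) (k : ℕ)
    (l : Loc β) (hp : σ.pc t = .hTag c k l) : k < (σ.res c.i (.normal c.j)).2 ∨
    (k = (σ.res c.i (.normal c.j)).2 ∧ (σ.pc c.i).active = some (c.j, k)) :=
  h.seen t c.i c.j k (by rw [hp]; rfl)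

section
variable [DecidableEq β]

set_option maxHeartbeats 40000000 in
theorem Proto.step {σ σ' : State n m β} {t : Fin n} {x : Act β} (h : Proto σ)
    (hs : Step σ t x σ') : Proto σ' := by
  constructor
  case tracking | request | looping | cancelTag | resEra | setRes | setTag | loadEra | casTag
    | announced =>
    have h_tracking := h.tracking
    have h_request := h.request
    have h_looping := h.looping
    have h_cancelTag := h.cancelTag
    have h_resEra := h.resEra
    have h_setRes := h.setRes
    have h_setTag := h.setTag
    have h_loadEra := h.loadEra
    have h_casTag := h.casTag
    have h_announced := h.announced
    have h_request_res := h.request_res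
    have h_cas := h.cas
    have h_pending_active := h.pending_active
    have h_poll := h.poll
    clear h
    cases hs
    all_goals
      try simp only [State.goto, State.setRes, State.setResEra, State.setResTag, State.setStRes,
        State.setRef, State.setStatus, State.gpReturn, update_apply, ite_apply]
      first
        | intro w
          by_cases hw : w = t
          · subst hw
            simp only [if_true, PC.tracking, PC.looping, PC.loadEra, PC.announced, reduceCtorEq,
              false_imp_iff, implies_true]
          · simp only [if_neg hw]
            first | exact h_tracking w | exact h_request w | exact h_looping w
              | exact h_cancelTag w | exact h_resEra w | exact h_setRes w | exact h_setTag w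
              | exact h_loadEra w | exact h_casTag w | exact h_announced w
        | grind [Caller.cont_cases, Result.era, PC.tracking, PC.looping, PC.active, PC.loadEra,
          PC.announced, PC.active_of_looping, PC.active_of_tracking, ENat.natCast_ne_top]
  case pub1 | ptr | tag | handing =>
    have h_pub1 := h.pub1
    have h_ptr := h.ptr
    have h_tag := h.tag
    have h_handing := h.handing
    have h_seen_pub1 := h.seen_pub1
    have h_seen_ptr := h.seen_ptr
    have h_seen_tag := h.seen_tag
    have h_seen_handing := h.seen_handing
    have h_cas := h.cas
    have h_pending_active := h.pending_active
    have h_cancelTag := h.cancelTag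
    have h_setTag := h.setTag
    clear h
    cases hs
    all_goals
      try simp only [State.goto, State.setRes, State.setResEra, State.setResTag, State.setStRes,
        State.setRef, State.setStatus, State.gpReturn, update_apply, ite_apply]
      first
        | intro w
          by_cases hw : w = t
          · subst hw
            simp only [if_true, PC.handing, reduceCtorEq, false_imp_iff, implies_true]
          · simp only [if_neg hw]
            first | exact h_pub1 w | exact h_ptr w | exact h_tag w | exact h_handing w
        | grind [Caller.cont_cases, Result.era, PC.active, PC.handing]
  case pending =>
    have h_pending := h.pending
    clear h
    cases hs
    all_goals
      try simp only [State.goto, State.setRes, State.setResEra, State.setResTag, State.setStRes,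
        State.setRef, State.setStatus, State.gpReturn, update_apply, ite_apply]
      grind [Caller.cont_cases, PC.loopReq]
  case seen =>
    have h_looping := h.looping
    have h_cancelTag := h.cancelTag
    have h_resEra := h.resEra
    have h_setRes := h.setRes
    have h_setTag := h.setTag
    have h_pending_active := h.pending_active
    have h_seen := h.seen
    have h_cas := h.cas
    have h_request := h.request
    clear h
    cases hs
    all_goals
      try simp only [State.goto, State.setRes, State.setResEra, State.setResTag, State.setStRes,
        State.setRef, State.setStatus, State.gpReturn, update_apply, ite_apply]
      grind [Caller.cont_cases, PC.active, PC.seen]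

end

/-! ### Protected blocks -/

/-- The arguments and the era read from the parent, before the era is stored for the helpers. -/
def PC.parentRead : PC n m β → Option (GPArgs m β × ℕ∞)
  | .gpStart a _ e | .gpSetPtr a _ e | .gpSetEra a _ e => some (a, e)
  | _ => none

/-- The arguments, while the era stored for the helpers is that of the present call. -/
def PC.posted : PC n m β → Option (GPArgs m β)
  | .gpGetTag a _ | .gpRequest a _ _
  | .gpLoad a _ _ | .gpCheck a _ _ _ | .gpCancel a _ _ _ _ | .gpUpdate a _ _ _ | .gpPoll a _ _
  | .gpCancelTag a _ _ | .gpResEra a _ _ | .gpSetRes a _ _ _ | .gpSetTag a _ _ => some a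
  | _ => none

/-- The index and the tag of a request at the control points where a result may exist whose era the
requester has not yet written into its reservation. -/
def PC.awaiting : PC n m β → Option (Fin m × ℕ)
  | .gpLoad a _ k | .gpCheck a _ k _ | .gpCancel a _ k _ _ | .gpUpdate a _ k _ | .gpPoll a _ k
  | .gpResEra a k _ | .gpSetRes a k _ _ => some (a.index, k)
  | _ => none

/-- The guards that the scheme maintains. For loaded pointers `r`, only those that
referred to a live block when they were loaded (`r.ref = some b`) matter. -/
structure Safe (σ : State n m β) : Prop where
  /-- References of the application are guarded by the normal reservation of their index. -/
  refs : ∀ t j b, σ.refs t j = some b →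
    Guard σ (σ.res t (.normal j)).1 t (.normal j) b
  /-- The era that is stored for the helpers is the `alloc_era` of the parent. -/
  parentRead : ∀ t a e b f, (σ.pc t).parentRead = some (a, e) → a.ptr = .field b f →
    e = (σ.allocEra b : ℕ∞)
  posted : ∀ t a b f, (σ.pc t).posted = some a → a.ptr = .field b f →
    σ.stEra t a.index = (σ.allocEra b : ℕ∞)
  /-- A pointer loaded under an era is guarded if the clock has not passed this era (which is
  finite: `∞` is excluded). The same holds in the loops of the slow path and of `help_thread()`. -/
  fast : ∀ t a e r b, σ.pc t = .gpFastCheck a e r → r.ref = some b → (σ.globalEra : ℕ∞) ≤ e →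
    e ≠ ⊤ → Guard σ e t (.normal a.index) b
  check : ∀ t a e k r b, σ.pc t = .gpCheck a e k r → σ.stRes t a.index = .pending k →
    r.ref = some b → (σ.globalEra : ℕ∞) ≤ e → e ≠ ⊤ → Guard σ e t (.normal a.index) b
  cancel : ∀ t a e k r c b, σ.pc t = .gpCancel a e k r c → σ.stRes t a.index = .pending k →
    r.ref = some b → Guard σ e t (.normal a.index) b
  cancelTag : ∀ t a k r b, σ.pc t = .gpCancelTag a k r → r.ref = some b →
    Guard σ (σ.res t (.normal a.index)).1 t (.normal a.index) b
  /-- A result is guarded by the helper until the tag changes, and by the requester after that. -/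
  handover : ∀ t j k p e b, (σ.pc t).awaiting = some (j, k) → σ.stRes t j = .done p e →
    p.ref = some b →
    ((σ.res t (.normal j)).2 = k ∧
      ∃ u, (σ.pc u).handing = some (t, j, k, e) ∧ Guard σ e u .special2 b) ∨
    ((σ.res t (.normal j)).2 = k + 1 ∧ Guard σ e t (.normal j) b)
  setTag : ∀ t a k r p e b, σ.pc t = .gpSetTag a k r → σ.stRes t a.index = .done p e →
    p.ref = some b → Guard σ e t (.normal a.index) b
  gpEnd : ∀ t a r b, σ.pc t = .gpEnd a r → r.ref = some b →
    Guard σ (σ.res t (.normal a.index)).1 t (.normal a.index) b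
  gpEnd_res : ∀ t a r p e b, σ.pc t = .gpEnd a r → σ.stRes t a.index = .done p e →
    p.ref = some b → Guard σ (σ.res t (.normal a.index)).1 t (.normal a.index) b
  helpCheck : ∀ t h k l e r b, σ.pc t = .hCheck h k l e r → r.ref = some b → σ.globalEra ≤ e →
    Guard σ (e : ℕ∞) t .special2 b
  helpCas : ∀ t h k l e r b, σ.pc t = .hCas h k l e r → r.ref = some b →
    Guard σ (e : ℕ∞) t .special2 b
  /-- The parent block is guarded by the first special reservation of the helper. -/
  helping : ∀ t b f, (σ.pc t).helping = some (.field b f) →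
    Guard σ (σ.res t .special1).1 t .special1 b

/-- The invariant of all reachable states. -/
structure Inv (σ : State n m β) : Prop where
  life : Life σ
  client : Client σ
  clock : Clock σ
  proto : Proto σ
  safe : Safe σ

/-- A guard for `b` at reservation `s` of thread `i` exists after the next step: the reservation
guards `b` now, or it is a normal one and `b` is guarded by a second special reservation with the
same era, which scans read earlier. -/
def Kept (σ : State n m β) (e : ℕ∞) (i : Fin n) (s : Slot m) (b : β) : Prop :=
  (Guard σ e i s b ∧ (σ.res i s).1 = e) ∨
  ∃ u j, s = .normal j ∧ Guard σ e u .special2 b ∧ (σ.res u .special2).1 = e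

theorem kept_of_guard {σ : State n m β} {e : ℕ∞} {i : Fin n} {s : Slot m} {b : β}
    (h : Guard σ e i s b) (he : (σ.res i s).1 = e) : Kept σ e i s b := .inl ⟨h, he⟩

theorem kept_of_special2 {σ : State n m β} {e : ℕ∞} {u i : Fin n} {j : Fin m} {b : β}
    (h : Guard σ e u .special2 b) (he : (σ.res u .special2).1 = e) :
    Kept σ e i (.normal j) b := .inr ⟨u, j, rfl, h, he⟩

theorem PC.args_of_active {p : PC n m β} {j : Fin m} {k : ℕ} (h : p.active = some (j, k)) :
    ∃ a, p.args = some a ∧ p.posted = some a ∧ p.announced = some a ∧ a.index = j := by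
  cases p <;> simp_all [PC.active, PC.args, PC.posted, PC.announced]

theorem PC.args_of_posted {p : PC n m β} {a : GPArgs m β} (h : p.posted = some a) :
    p.args = some a := by
  cases p <;> simp_all [PC.args, PC.posted]

theorem PC.args_of_parentRead {p : PC n m β} {a : GPArgs m β} {e : ℕ∞}
    (h : p.parentRead = some (a, e)) : p.args = some a := by
  cases p <;> simp_all [PC.args, PC.parentRead]

theorem PC.active_of_awaiting {p : PC n m β} {j : Fin m} {k : ℕ} (h : p.awaiting = some (j, k)) :
    p.active = some (j, k) := by
  cases p <;> simp_all [PC.active, PC.awaiting]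

section
variable {σ : State n m β} (h : Inv σ)
include h

/-- The parent block is not being allocated, so its `alloc_era` does not change. -/
theorem Inv.not_alStamp (t : Fin n) (a : GPArgs m β) (b : β) (f : ℕ)
    (ha : (σ.pc t).args = some a) (hb : a.ptr = .field b f) (u : Fin n) :
    σ.pc u ≠ .alStamp b := by
  intro hu
  obtain ⟨-, j, -, hj⟩ := h.client.parent_field t a ha b f hb
  have h1 := (h.safe.refs t j b hj).alive
  simp [h.life.allocating u b hu] at h1

theorem Inv.unused_active (t : Fin n) (j : Fin m) (k : ℕ)
    (ha : (σ.pc t).active = some (j, k)) : σ.refs t j = none := by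
  obtain ⟨a, h1, -, -, rfl⟩ := PC.args_of_active ha
  exact h.client.unused t a h1

/-- While a result is awaited, the reservation changes only by the wide CAS of a helper,
  which writes
the era of the result. -/
theorem Inv.awaiting_res (t : Fin n) (j : Fin m) (k : ℕ) (p : Loaded β) (e : ℕ∞)
    (ha : (σ.pc t).awaiting = some (j, k)) (hr : σ.stRes t j = .done p e) :
    (σ.res t (.normal j)).2 = k ∨ σ.res t (.normal j) = (e, k + 1) := by
  rcases hl : (σ.pc t).looping with - | ⟨a, e', k'⟩
  · cases hp : σ.pc t <;> simp [hp, PC.awaiting, PC.looping] at ha hl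
    · obtain ⟨rfl, rfl⟩ := ha
      have := h.proto.resEra _ _ _ _ hp
      grind
    · obtain ⟨rfl, rfl⟩ := ha
      have := h.proto.setRes _ _ _ _ _ hp
      grind
  · have h1 := PC.active_of_looping hl
    have h2 := PC.active_of_awaiting ha
    have := h.proto.looping _ _ _ _ hl
    grind

theorem Inv.handing_special2 (u i : Fin n) (j : Fin m) (k : ℕ) (e : ℕ∞)
    (hu : (σ.pc u).handing = some (i, j, k, e)) : (σ.res u .special2).1 = e :=
  h.proto.loadEra u e (PC.loadEra_of_handing hu)

/-- The requester may write the era of a result into its reservation. -/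
theorem Inv.handover_kept (t : Fin n) (j : Fin m) (k : ℕ) (p : Loaded β) (e : ℕ∞) (b : β)
    (ha : (σ.pc t).awaiting = some (j, k)) (hr : σ.stRes t j = .done p e) (hb : p.ref = some b) :
    Kept σ e t (.normal j) b := by
  have h1 := h.awaiting_res t j k p e ha hr
  rcases h.safe.handover t j k p e b ha hr hb with ⟨-, u, hu, hg⟩ | ⟨h2, hg⟩
  · exact kept_of_special2 hg (h.handing_special2 u t j k e hu)
  · refine kept_of_guard hg ?_
    grind

/-- A successful tag check shows that the request is still being served. So the requester holds a
protected reference to the parent, and this guard extends to the first special reservation of the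
helper, which contains the `alloc_era` of the parent and is read later by every scan. -/
theorem Inv.parent_guard (t : Fin n) (c : HelpCtx n m) (k : ℕ) (b : β) (f : ℕ)
    (hp : σ.pc t = .hTag c k (.field b f)) (hk : (σ.res c.i (.normal c.j)).2 = k) :
    Guard σ (σ.res t .special1).1 t .special1 b := by
  obtain ⟨h1, h2⟩ := h.proto.tag t c k _ hp hk
  rcases h.proto.seen_tag t c k _ hp with h3 | ⟨-, h3⟩
  · omega
  obtain ⟨a, ha, hpo, han, hj⟩ := PC.args_of_active h3
  have h4 := h.proto.announced _ _ han
  have hptr : a.ptr = .field b f := by rw [← h4, hj, h2]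
  obtain ⟨-, j, -, hr⟩ := h.client.parent_field _ _ ha b f hptr
  have hg := h.safe.refs _ _ _ hr
  rw [h1, ← hj, h.safe.posted _ _ b f hpo hptr]
  exact
    { alive := hg.alive
      alloc_le := le_rfl
      le_clock := hg.alloc_le.trans hg.le_clock
      le_retire := fun u hu => hg.alloc_le.trans (hg.le_retire u hu)
      scan := fun u l r hu => normal_before_special1 (h.life.order _ _ _ _ hu) (hg.scan u l r hu) }

end

theorem kept_of_load {σ : State n m β} {l : Loc β} {b : β} {e : ℕ∞} {i : Fin n} {s : Slot m}
    (h : Life σ) (hb : (σ.load l).ref = some b) (hG : (σ.globalEra : ℕ∞) ≤ e) (ht : e ≠ ⊤)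
    (hok : EraOk σ e) (he : (σ.res i s).1 = e) : Kept σ e i s b :=
  kept_of_guard (guard_of_load h hb ((hok.resolve_left ht).antisymm hG) i s) he

section
variable [DecidableEq β]

/-- The next step may write the era into the reservation, so a block can pass from the guard of a
second special reservation to that of a normal one. -/
theorem Kept.step {σ σ' : State n m β} {t : Fin n} {x : Act β} {e : ℕ∞} {i : Fin n} {s : Slot m}
    {b : β} (hk : Kept σ e i s b) (h : Life σ) (hs : Step σ t x σ') : Guard σ' e i s b := by
  rcases hk with ⟨hg, he⟩ | ⟨u, j, rfl, hg, he⟩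
  · exact hg.step h hs he
  · have hg' := hg.step h hs he
    exact { hg' with
      scan := fun t l r hp => special2_before_normal ((h.step hs).order _ _ _ _ hp)
        (hg'.scan t l r hp) }

/-- A helper leaves the handover of its reservation only when the tag has changed. -/
theorem Step.handing {σ σ' : State n m β} {t : Fin n} {x : Act β} (h : Proto σ)
    (hs : Step σ t x σ') (u i : Fin n) (j : Fin m) (k : ℕ) (e : ℕ∞)
    (hu : (σ.pc u).handing = some (i, j, k, e)) (hk : (σ.res i (.normal j)).2 = k)
    (hk' : (σ'.res i (.normal j)).2 = k) : (σ'.pc u).handing = some (i, j, k, e) := by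
  have h_casTag := h.casTag
  clear h
  revert hk'
  cases hs
  all_goals
    try simp only [State.goto, State.setRes, State.setResEra, State.setResTag, State.setStRes,
      State.setRef, State.setStatus, State.gpReturn, update_apply, ite_apply]
    grind [Caller.cont_cases, PC.handing]

set_option maxHeartbeats 4000000 in
/-- By `Kept.step` it suffices to have a guard in the state before the step. It is provided by `h_keep`
for steps that do not concern the assertion, and by the other hypotheses for the steps that
establish it. The other guards of `Safe` are obtained in the same way. -/
theorem Inv.step_refs {σ σ' : State n m β} {t : Fin n} {x : Act β} (h : Inv σ)
    (hs : Step σ t x σ') :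
    ∀ t j b, σ'.refs t j = some b →
    Guard σ' (σ'.res t (.normal j)).1 t (.normal j) b := by
  suffices H : ∀ t j b, σ'.refs t j = some b →
    Kept σ (σ'.res t (.normal j)).1 t (.normal j) b from
    fun t j b hr => (H t j b hr).step h.life hs
  have h_keep : ∀ t j b, σ.refs t j = some b →
    Kept σ (σ.res t (.normal j)).1 t (.normal j) b :=
    fun t j b hr => kept_of_guard (h.safe.refs t j b hr) rfl
  have h_fast : ∀ t a e r b, σ.pc t = .gpFastCheck a e r → r.ref = some b →
      e = (σ.globalEra : ℕ∞) →
      Kept σ (σ.res t (.normal a.index)).1 t (.normal a.index) b := by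
    intro t a e r b hp hb he
    have htr := h.proto.tracking t a e (by rw [hp]; rfl)
    refine kept_of_guard ?_ rfl
    rw [htr]
    exact h.safe.fast t a e r b hp hb he.ge (by simp [he])
  have h_end : ∀ t a r b, σ.pc t = .gpEnd a r → r.ref = some b →
      Kept σ (σ.res t (.normal a.index)).1 t (.normal a.index) b :=
    fun t a r b hp hb => kept_of_guard (h.safe.gpEnd t a r b hp hb) rfl
  have h_publish : ∀ t a e, σ.pc t = .gpFastPublish a e → σ.refs t a.index = none :=
    fun t a e hp => h.client.unused t a (by rw [hp]; rfl)
  have h_update : ∀ t a e k c, σ.pc t = .gpUpdate a e k c → σ.refs t a.index = none :=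
    fun t a e k c hp => h.client.unused t a (by rw [hp]; rfl)
  have h_setRes : ∀ t a k r e, σ.pc t = .gpSetRes a k r e → σ.refs t a.index = none :=
    fun t a k r e hp => h.client.unused t a (by rw [hp]; rfl)
  have h_unused := h.unused_active
  have h_cas := h.proto.cas
  have h_cleared := h.client.cleared
  clear h
  cases hs
  all_goals
    try simp only [State.goto, State.setRes, State.setResEra, State.setResTag, State.setStRes,
      State.setRef, State.setStatus, State.gpReturn, update_apply, ite_apply]
    first
      | intro w
        by_cases hw : w = t
        · subst hw
          simp only [if_true, reduceCtorEq, false_imp_iff, implies_true]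
        · simp only [if_neg hw]
          exact h_keep w
      | grind [Caller.cont_cases]

set_option maxHeartbeats 4000000 in
theorem Inv.step_parentRead {σ σ' : State n m β} {t : Fin n} {x : Act β} (h : Inv σ)
    (hs : Step σ t x σ') :
    ∀ t a e b f, (σ'.pc t).parentRead = some (a, e) → a.ptr = .field b f →
    e = (σ'.allocEra b : ℕ∞) := by
  have h_keep := h.safe.parentRead
  have h_root := h.client.parent_root
  have h_field := h.client.parent_field
  have h_not := h.not_alStamp
  have h_args := fun t a e (hp : (σ.pc t).parentRead = some (a, e)) => PC.args_of_parentRead hp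
  clear h
  cases hs
  all_goals
    try simp only [State.goto, State.setRes, State.setResEra, State.setResTag, State.setStRes,
      State.setRef, State.setStatus, State.gpReturn, update_apply]
    first
      | intro w
        by_cases hw : w = t
        · subst hw
          simp only [if_true, PC.parentRead, reduceCtorEq, false_imp_iff, implies_true]
        · simp only [if_neg hw]
          exact h_keep w
      | grind [Caller.cont_cases, PC.parentRead, PC.args]

set_option maxHeartbeats 4000000 in
theorem Inv.step_posted {σ σ' : State n m β} {t : Fin n} {x : Act β} (h : Inv σ)
    (hs : Step σ t x σ') :
    ∀ t a b f, (σ'.pc t).posted = some a → a.ptr = .field b f →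
    σ'.stEra t a.index = (σ'.allocEra b : ℕ∞) := by
  have h_keep := h.safe.posted
  have h_setEra : ∀ t a c e b f, σ.pc t = .gpSetEra a c e → a.ptr = .field b f →
      e = (σ.allocEra b : ℕ∞) := fun t a c e b f hp hb =>
    h.safe.parentRead t a e b f (by rw [hp]; rfl) hb
  have h_not := h.not_alStamp
  have h_args := fun t a (hp : (σ.pc t).posted = some a) => PC.args_of_posted hp
  clear h
  cases hs
  all_goals
    try simp only [State.goto, State.setRes, State.setResEra, State.setResTag, State.setStRes,
      State.setRef, State.setStatus, State.gpReturn, update_apply, ite_apply]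
    first
      | intro w
        by_cases hw : w = t
        · subst hw
          simp only [if_true, PC.posted, reduceCtorEq, false_imp_iff, implies_true]
        · simp only [if_neg hw]
          exact h_keep w
      | grind [Caller.cont_cases, PC.posted, PC.args]

set_option maxHeartbeats 4000000 in
theorem Inv.step_fast {σ σ' : State n m β} {t : Fin n} {x : Act β} (h : Inv σ)
    (hs : Step σ t x σ') :
    ∀ t a e r b, σ'.pc t = .gpFastCheck a e r → r.ref = some b → (σ'.globalEra : ℕ∞) ≤ e →
    e ≠ ⊤ → Guard σ' e t (.normal a.index) b := by
  suffices H : ∀ t a e r b, σ'.pc t = .gpFastCheck a e r → r.ref = some b →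
    (σ.globalEra : ℕ∞) ≤ e → e ≠ ⊤ → Kept σ e t (.normal a.index) b from
    fun t a e r b hp hb hG ht =>
    (H t a e r b hp hb (le_trans (by exact_mod_cast hs.clock_le) hG) ht).step h.life hs
  have h_keep : ∀ t a e r b, σ.pc t = .gpFastCheck a e r → r.ref = some b →
    (σ.globalEra : ℕ∞) ≤ e → e ≠ ⊤ → Kept σ e t (.normal a.index) b :=
    fun t a e r b hp hb hG ht =>
    kept_of_guard (h.safe.fast t a e r b hp hb hG ht) (h.proto.tracking t a e (by rw [hp]; rfl))
  have h_load : ∀ t a e b, σ.pc t = .gpFast a e → (σ.load a.ptr).ref = some b →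
      (σ.globalEra : ℕ∞) ≤ e → e ≠ ⊤ → Kept σ e t (.normal a.index) b := by
    intro t a e b hp hb hG ht
    have htr := h.proto.tracking t a e (by rw [hp]; rfl)
    exact kept_of_load h.life hb hG ht (htr ▸ h.clock.res t a.index) htr
  clear h
  cases hs
  all_goals
    try simp only [State.goto, State.setRes, State.setResEra, State.setResTag, State.setStRes,
      State.setRef, State.setStatus, State.gpReturn, update_apply]
    first
      | intro w
        by_cases hw : w = t
        · subst hw
          simp only [if_true, reduceCtorEq, false_imp_iff, implies_true]
        · simp only [if_neg hw]
          exact h_keep w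
      | grind [Caller.cont_cases]

set_option maxHeartbeats 4000000 in
theorem Inv.step_check {σ σ' : State n m β} {t : Fin n} {x : Act β} (h : Inv σ)
    (hs : Step σ t x σ') :
    ∀ t a e k r b, σ'.pc t = .gpCheck a e k r → σ'.stRes t a.index = .pending k →
    r.ref = some b → (σ'.globalEra : ℕ∞) ≤ e → e ≠ ⊤ → Guard σ' e t (.normal a.index) b := by
  suffices H : ∀ t a e k r b, σ'.pc t = .gpCheck a e k r → σ'.stRes t a.index = .pending k →
    r.ref = some b → (σ.globalEra : ℕ∞) ≤ e → e ≠ ⊤ → Kept σ e t (.normal a.index) b from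
    fun t a e k r b hp hr hb hG ht =>
    (H t a e k r b hp hr hb (le_trans (by exact_mod_cast hs.clock_le) hG) ht).step h.life hs
  have h_res : ∀ t a e k, (σ.pc t).looping = some (a, e, k) → σ.stRes t a.index = .pending k →
      (σ.res t (.normal a.index)).1 = e := by
    intro t a e k hp hr
    have := h.proto.looping t a e k hp
    grind
  have h_keep : ∀ t a e k r b, σ.pc t = .gpCheck a e k r → σ.stRes t a.index = .pending k →
    r.ref = some b → (σ.globalEra : ℕ∞) ≤ e → e ≠ ⊤ → Kept σ e t (.normal a.index) b :=
    fun t a e k r b hp hr hb hG ht =>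
    kept_of_guard (h.safe.check t a e k r b hp hr hb hG ht) (h_res t a e k (by rw [hp]; rfl) hr)
  have h_load : ∀ t a e k b, σ.pc t = .gpLoad a e k → σ.stRes t a.index = .pending k →
      (σ.load a.ptr).ref = some b → (σ.globalEra : ℕ∞) ≤ e → e ≠ ⊤ →
      Kept σ e t (.normal a.index) b := by
    intro t a e k b hp hr hb hG ht
    have he := h_res t a e k (by rw [hp]; rfl) hr
    exact kept_of_load h.life hb hG ht (he ▸ h.clock.res t a.index) he
  clear h
  cases hs
  all_goals
    try simp only [State.goto, State.setRes, State.setResEra, State.setResTag, State.setStRes,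
      State.setRef, State.setStatus, State.gpReturn, update_apply, ite_apply]
    first
      | intro w
        by_cases hw : w = t
        · subst hw
          simp only [if_true, reduceCtorEq, false_imp_iff, implies_true]
        · simp only [if_neg hw]
          exact h_keep w
      | grind [Caller.cont_cases]

set_option maxHeartbeats 4000000 in
theorem Inv.step_cancel {σ σ' : State n m β} {t : Fin n} {x : Act β} (h : Inv σ)
    (hs : Step σ t x σ') :
    ∀ t a e k r c b, σ'.pc t = .gpCancel a e k r c → σ'.stRes t a.index = .pending k →
    r.ref = some b → Guard σ' e t (.normal a.index) b := by
  suffices H : ∀ t a e k r c b, σ'.pc t = .gpCancel a e k r c → σ'.stRes t a.index = .pending k →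
    r.ref = some b → Kept σ e t (.normal a.index) b from
    fun t a e k r c b hp hr hb => (H t a e k r c b hp hr hb).step h.life hs
  have h_res : ∀ t a e k, (σ.pc t).looping = some (a, e, k) → σ.stRes t a.index = .pending k →
      (σ.res t (.normal a.index)).1 = e := by
    intro t a e k hp hr
    have := h.proto.looping t a e k hp
    grind
  have h_keep : ∀ t a e k r c b, σ.pc t = .gpCancel a e k r c → σ.stRes t a.index = .pending k →
    r.ref = some b → Kept σ e t (.normal a.index) b :=
    fun t a e k r c b hp hr hb =>
    kept_of_guard (h.safe.cancel t a e k r c b hp hr hb) (h_res t a e k (by rw [hp]; rfl) hr)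
  have h_check : ∀ t a e k r b, σ.pc t = .gpCheck a e k r → σ.stRes t a.index = .pending k →
      r.ref = some b → e = (σ.globalEra : ℕ∞) → Kept σ e t (.normal a.index) b := by
    intro t a e k r b hp hr hb he
    exact kept_of_guard (h.safe.check t a e k r b hp hr hb he.ge (by simp [he]))
      (h_res t a e k (by rw [hp]; rfl) hr)
  clear h
  cases hs
  all_goals
    try simp only [State.goto, State.setRes, State.setResEra, State.setResTag, State.setStRes,
      State.setRef, State.setStatus, State.gpReturn, update_apply, ite_apply]
    first
      | intro w
        by_cases hw : w = t
        · subst hw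
          simp only [if_true, reduceCtorEq, false_imp_iff, implies_true]
        · simp only [if_neg hw]
          exact h_keep w
      | grind [Caller.cont_cases]

set_option maxHeartbeats 4000000 in
theorem Inv.step_cancelTag {σ σ' : State n m β} {t : Fin n} {x : Act β} (h : Inv σ)
    (hs : Step σ t x σ') :
    ∀ t a k r b, σ'.pc t = .gpCancelTag a k r → r.ref = some b →
    Guard σ' (σ'.res t (.normal a.index)).1 t (.normal a.index) b := by
  suffices H : ∀ t a k r b, σ'.pc t = .gpCancelTag a k r → r.ref = some b →
    Kept σ (σ'.res t (.normal a.index)).1 t (.normal a.index) b from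
    fun t a k r b hp hb => (H t a k r b hp hb).step h.life hs
  have h_res : ∀ t a e k, (σ.pc t).looping = some (a, e, k) → σ.stRes t a.index = .pending k →
      (σ.res t (.normal a.index)).1 = e := by
    intro t a e k hp hr
    have := h.proto.looping t a e k hp
    grind
  have h_keep : ∀ t a k r b, σ.pc t = .gpCancelTag a k r → r.ref = some b →
    Kept σ (σ.res t (.normal a.index)).1 t (.normal a.index) b :=
    fun t a k r b hp hb => kept_of_guard (h.safe.cancelTag t a k r b hp hb) rfl
  have h_cancel : ∀ t a e k r c b, σ.pc t = .gpCancel a e k r c →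
      σ.stRes t a.index = .pending k → r.ref = some b →
      Kept σ (σ.res t (.normal a.index)).1 t (.normal a.index) b := by
    intro t a e k r c b hp hr hb
    rw [h_res t a e k (by rw [hp]; rfl) hr]
    exact kept_of_guard (h.safe.cancel t a e k r c b hp hr hb) (h_res t a e k (by rw [hp]; rfl) hr)
  have h_cas := h.proto.cas
  have h_cancelTag := h.proto.cancelTag
  clear h
  cases hs
  all_goals
    try simp only [State.goto, State.setRes, State.setResEra, State.setResTag, State.setStRes,
      State.setRef, State.setStatus, State.gpReturn, update_apply, ite_apply]
    first
      | intro w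
        by_cases hw : w = t
        · subst hw
          simp only [if_true, reduceCtorEq, false_imp_iff, implies_true]
        · simp only [if_neg hw]
          exact h_keep w
      | grind [Caller.cont_cases, Result.era, ENat.natCast_ne_top]

set_option maxHeartbeats 4000000 in
theorem Inv.step_handover {σ σ' : State n m β} {t : Fin n} {x : Act β} (h : Inv σ)
    (hs : Step σ t x σ') :
    ∀ t j k p e b, (σ'.pc t).awaiting = some (j, k) → σ'.stRes t j = .done p e →
    p.ref = some b →
    ((σ'.res t (.normal j)).2 = k ∧
      ∃ u, (σ'.pc u).handing = some (t, j, k, e) ∧ Guard σ' e u .special2 b) ∨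
    ((σ'.res t (.normal j)).2 = k + 1 ∧ Guard σ' e t (.normal j) b) := by
  suffices H : ∀ w j k p e b, (σ'.pc w).awaiting = some (j, k) → σ'.stRes w j = .done p e →
    p.ref = some b →
    ((σ'.res w (.normal j)).2 = k ∧
      ((∃ u, (σ.pc u).handing = some (w, j, k, e) ∧ (σ.res w (.normal j)).2 = k ∧
          Kept σ e u .special2 b) ∨
        ((σ'.pc t).handing = some (w, j, k, e) ∧ Kept σ e t .special2 b))) ∨
    ((σ'.res w (.normal j)).2 = k + 1 ∧ Kept σ e w (.normal j) b) from by
    intro w j k p e b ha hr hb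
    rcases H w j k p e b ha hr hb with ⟨h1, ⟨u, h2, h3, h4⟩ | ⟨h2, h3⟩⟩ | ⟨h1, h2⟩
    · exact .inl ⟨h1, u, hs.handing h.proto u w j k e h2 h3 h1, h4.step h.life hs⟩
    · exact .inl ⟨h1, t, h2, h3.step h.life hs⟩
    · exact .inr ⟨h1, h2.step h.life hs⟩
  have h_keep : ∀ w j k p e b, (σ.pc w).awaiting = some (j, k) → σ.stRes w j = .done p e →
      p.ref = some b → ((σ.res w (.normal j)).2 = k ∧
      ∃ u, (σ.pc u).handing = some (w, j, k, e) ∧ (σ.res w (.normal j)).2 = k ∧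
        Kept σ e u .special2 b) ∨
      ((σ.res w (.normal j)).2 = k + 1 ∧ Kept σ e w (.normal j) b) := by
    intro w j k p e b ha hr hb
    rcases h.safe.handover w j k p e b ha hr hb with ⟨h1, u, h2, h3⟩ | ⟨h1, -⟩
    · exact .inl ⟨h1, u, h2, h1, kept_of_guard h3 (h.handing_special2 u w j k e h2)⟩
    · exact .inr ⟨h1, h.handover_kept w j k p e b ha hr hb⟩
  have h_kept := h.handover_kept
  have h_cas := h.proto.cas
  have h_pending := h.proto.pending_active
  have h_active := fun w j k (hp : (σ.pc w).awaiting = some (j, k)) => PC.active_of_awaiting hp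
  have h_helpCas : ∀ t c k l e r b, σ.pc t = .hCas c k l e r → r.ref = some b →
      Kept σ (e : ℕ∞) t .special2 b := fun t c k l e r b hp hb =>
    kept_of_guard (h.safe.helpCas t c k l e r b hp hb) (h.proto.loadEra t e (by rw [hp]; rfl))
  clear h
  cases hs
  all_goals
    try simp only [State.goto, State.setRes, State.setResEra, State.setResTag, State.setStRes,
      State.setRef, State.setStatus, State.gpReturn, update_apply, ite_apply]
    first
      | intro w
        by_cases hw : w = t
        · subst hw
          simp only [if_true, PC.awaiting, reduceCtorEq, false_imp_iff, implies_true]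
        · simp only [if_neg hw]
          exact fun j k p e b ha hr hb =>
            (h_keep w j k p e b ha hr hb).imp_left fun ⟨h1, h2⟩ => ⟨h1, .inl h2⟩
      | grind [Caller.cont_cases, PC.awaiting, PC.handing, PC.active]

set_option maxHeartbeats 4000000 in
theorem Inv.step_setTag {σ σ' : State n m β} {t : Fin n} {x : Act β} (h : Inv σ)
    (hs : Step σ t x σ') :
    ∀ t a k r p e b, σ'.pc t = .gpSetTag a k r → σ'.stRes t a.index = .done p e →
    p.ref = some b → Guard σ' e t (.normal a.index) b := by
  suffices H : ∀ t a k r p e b, σ'.pc t = .gpSetTag a k r → σ'.stRes t a.index = .done p e →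
    p.ref = some b → Kept σ e t (.normal a.index) b from
    fun t a k r p e b hp hr hb => (H t a k r p e b hp hr hb).step h.life hs
  have h_keep : ∀ t a k r p e b, σ.pc t = .gpSetTag a k r → σ.stRes t a.index = .done p e →
    p.ref = some b → Kept σ e t (.normal a.index) b := by
    intro t a k r p e b hp hr hb
    refine kept_of_guard (h.safe.setTag t a k r p e b hp hr hb) ?_
    have := h.proto.setTag t a k r hp
    grind
  have h_setRes : ∀ t a k r e p e' b, σ.pc t = .gpSetRes a k r e → σ.stRes t a.index = .done p e' →
      p.ref = some b → Kept σ e' t (.normal a.index) b :=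
    fun t a k r e p e' b hp hr hb => h.handover_kept t a.index k p e' b (by rw [hp]; rfl) hr hb
  have h_setTag := h.proto.setTag
  clear h
  cases hs
  all_goals
    try simp only [State.goto, State.setRes, State.setResEra, State.setResTag, State.setStRes,
      State.setRef, State.setStatus, State.gpReturn, update_apply, ite_apply]
    first
      | intro w
        by_cases hw : w = t
        · subst hw
          simp only [if_true, reduceCtorEq, false_imp_iff, implies_true]
        · simp only [if_neg hw]
          exact h_keep w
      | grind [Caller.cont_cases]

set_option maxHeartbeats 4000000 in
theorem Inv.step_gpEnd {σ σ' : State n m β} {t : Fin n} {x : Act β} (h : Inv σ)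
    (hs : Step σ t x σ') :
    ∀ t a r b, σ'.pc t = .gpEnd a r → r.ref = some b →
    Guard σ' (σ'.res t (.normal a.index)).1 t (.normal a.index) b := by
  suffices H : ∀ t a r b, σ'.pc t = .gpEnd a r → r.ref = some b →
    Kept σ (σ'.res t (.normal a.index)).1 t (.normal a.index) b from
    fun t a r b hp hb => (H t a r b hp hb).step h.life hs
  have h_keep : ∀ t a r b, σ.pc t = .gpEnd a r → r.ref = some b →
    Kept σ (σ.res t (.normal a.index)).1 t (.normal a.index) b :=
    fun t a r b hp hb => kept_of_guard (h.safe.gpEnd t a r b hp hb) rfl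
  have h_cancelTag : ∀ t a k r b, σ.pc t = .gpCancelTag a k r → r.ref = some b →
      Kept σ (σ.res t (.normal a.index)).1 t (.normal a.index) b :=
    fun t a k r b hp hb => kept_of_guard (h.safe.cancelTag t a k r b hp hb) rfl
  have h_setTag : ∀ t a k r b, σ.pc t = .gpSetTag a k r → r.ref = some b →
      Kept σ (σ.res t (.normal a.index)).1 t (.normal a.index) b := by
    intro t a k r b hp hb
    obtain ⟨e, he, he'⟩ := h.proto.setTag t a k r hp
    have hg := h.safe.setTag t a k r r e b hp he hb
    have h1 : (σ.res t (.normal a.index)).1 = e := by grind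
    exact kept_of_guard (h1 ▸ hg) rfl
  have h_cas := h.proto.cas
  clear h
  cases hs
  all_goals
    try simp only [State.goto, State.setRes, State.setResEra, State.setResTag, State.setStRes,
      State.setRef, State.setStatus, State.gpReturn, update_apply, ite_apply]
    first
      | intro w
        by_cases hw : w = t
        · subst hw
          simp only [if_true, reduceCtorEq, false_imp_iff, implies_true]
        · simp only [if_neg hw]
          exact h_keep w
      | grind [Caller.cont_cases, PC.active]

set_option maxHeartbeats 4000000 in
theorem Inv.step_gpEnd_res {σ σ' : State n m β} {t : Fin n} {x : Act β} (h : Inv σ)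
    (hs : Step σ t x σ') :
    ∀ t a r p e b, σ'.pc t = .gpEnd a r → σ'.stRes t a.index = .done p e →
    p.ref = some b → Guard σ' (σ'.res t (.normal a.index)).1 t (.normal a.index) b := by
  suffices H : ∀ t a r p e b, σ'.pc t = .gpEnd a r → σ'.stRes t a.index = .done p e →
    p.ref = some b → Kept σ (σ'.res t (.normal a.index)).1 t (.normal a.index) b from
    fun t a r p e b hp hr hb => (H t a r p e b hp hr hb).step h.life hs
  have h_keep : ∀ t a r p e b, σ.pc t = .gpEnd a r → σ.stRes t a.index = .done p e →
    p.ref = some b → Kept σ (σ.res t (.normal a.index)).1 t (.normal a.index) b :=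
    fun t a r p e b hp hr hb =>
    kept_of_guard (h.safe.gpEnd_res t a r p e b hp hr hb) rfl
  have h_cancelTag := h.proto.cancelTag
  have h_setTag : ∀ t a k r p e b, σ.pc t = .gpSetTag a k r → σ.stRes t a.index = .done p e →
      p.ref = some b → Kept σ (σ.res t (.normal a.index)).1 t (.normal a.index) b := by
    intro t a k r p e b hp hr hb
    have hg := h.safe.setTag t a k r p e b hp hr hb
    have := h.proto.setTag t a k r hp
    have h1 : (σ.res t (.normal a.index)).1 = e := by grind
    exact kept_of_guard (h1 ▸ hg) rfl
  have h_cas := h.proto.cas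
  have h_pending := h.proto.pending_active
  clear h
  cases hs
  all_goals
    try simp only [State.goto, State.setRes, State.setResEra, State.setResTag, State.setStRes,
      State.setRef, State.setStatus, State.gpReturn, update_apply, ite_apply]
    first
      | intro w
        by_cases hw : w = t
        · subst hw
          simp only [if_true, reduceCtorEq, false_imp_iff, implies_true]
        · simp only [if_neg hw]
          exact h_keep w
      | grind [Caller.cont_cases, PC.active, Loaded.ref]

set_option maxHeartbeats 4000000 in
theorem Inv.step_helpCheck {σ σ' : State n m β} {t : Fin n} {x : Act β} (h : Inv σ)
    (hs : Step σ t x σ') :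
    ∀ t h k l e r b, σ'.pc t = .hCheck h k l e r → r.ref = some b → σ'.globalEra ≤ e →
    Guard σ' (e : ℕ∞) t .special2 b := by
  suffices H : ∀ t h k l e r b, σ'.pc t = .hCheck h k l e r → r.ref = some b → σ.globalEra ≤ e →
    Kept σ (e : ℕ∞) t .special2 b from
    fun t c k l e r b hp hb hG => (H t c k l e r b hp hb (hs.clock_le.trans hG)).step h.life hs
  have h_keep : ∀ t h k l e r b, σ.pc t = .hCheck h k l e r → r.ref = some b → σ.globalEra ≤ e →
    Kept σ (e : ℕ∞) t .special2 b :=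
    fun t c k l e r b hp hb hG =>
    kept_of_guard (h.safe.helpCheck t c k l e r b hp hb hG) (h.proto.loadEra t e (by rw [hp]; rfl))
  have h_load : ∀ t c k l e b, σ.pc t = .hLoad c k l e → (σ.load l).ref = some b →
      σ.globalEra ≤ e → Kept σ (e : ℕ∞) t .special2 b := by
    intro t c k l e b hp hb hG
    exact kept_of_load h.life hb (by exact_mod_cast hG) (by simp)
      (h.clock.pc t e (by rw [hp]; rfl)) (h.proto.loadEra t e (by rw [hp]; rfl))
  clear h
  cases hs
  all_goals
    try simp only [State.goto, State.setRes, State.setResEra, State.setResTag, State.setStRes,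
      State.setRef, State.setStatus, State.gpReturn, update_apply]
    first
      | intro w
        by_cases hw : w = t
        · subst hw
          simp only [if_true, reduceCtorEq, false_imp_iff, implies_true]
        · simp only [if_neg hw]
          exact h_keep w
      | grind [Caller.cont_cases]

set_option maxHeartbeats 4000000 in
theorem Inv.step_helpCas {σ σ' : State n m β} {t : Fin n} {x : Act β} (h : Inv σ)
    (hs : Step σ t x σ') :
    ∀ t h k l e r b, σ'.pc t = .hCas h k l e r → r.ref = some b →
    Guard σ' (e : ℕ∞) t .special2 b := by
  suffices H : ∀ t h k l e r b, σ'.pc t = .hCas h k l e r → r.ref = some b →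
    Kept σ (e : ℕ∞) t .special2 b from
    fun t c k l e r b hp hb => (H t c k l e r b hp hb).step h.life hs
  have h_keep : ∀ t h k l e r b, σ.pc t = .hCas h k l e r → r.ref = some b →
    Kept σ (e : ℕ∞) t .special2 b :=
    fun t c k l e r b hp hb =>
    kept_of_guard (h.safe.helpCas t c k l e r b hp hb) (h.proto.loadEra t e (by rw [hp]; rfl))
  have h_check : ∀ t c k l e r b, σ.pc t = .hCheck c k l e r → r.ref = some b →
      e = σ.globalEra → Kept σ (e : ℕ∞) t .special2 b := fun t c k l e r b hp hb he =>
    kept_of_guard (h.safe.helpCheck t c k l e r b hp hb he.ge)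
      (h.proto.loadEra t e (by rw [hp]; rfl))
  clear h
  cases hs
  all_goals
    try simp only [State.goto, State.setRes, State.setResEra, State.setResTag, State.setStRes,
      State.setRef, State.setStatus, State.gpReturn, update_apply]
    first
      | intro w
        by_cases hw : w = t
        · subst hw
          simp only [if_true, reduceCtorEq, false_imp_iff, implies_true]
        · simp only [if_neg hw]
          exact h_keep w
      | grind [Caller.cont_cases]

set_option maxHeartbeats 4000000 in
theorem Inv.step_helping {σ σ' : State n m β} {t : Fin n} {x : Act β} (h : Inv σ)
    (hs : Step σ t x σ') :
    ∀ t b f, (σ'.pc t).helping = some (.field b f) →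
    Guard σ' (σ'.res t .special1).1 t .special1 b := by
  suffices H : ∀ t b f, (σ'.pc t).helping = some (.field b f) →
    Kept σ (σ'.res t .special1).1 t .special1 b from
    fun t b f hp => (H t b f hp).step h.life hs
  have h_keep : ∀ t b f, (σ.pc t).helping = some (.field b f) →
    Kept σ (σ.res t .special1).1 t .special1 b :=
    fun t b f hp => kept_of_guard (h.safe.helping t b f hp) rfl
  have h_tag : ∀ t c k b f, σ.pc t = .hTag c k (.field b f) →
      (σ.res c.i (.normal c.j)).2 = k → Kept σ (σ.res t .special1).1 t .special1 b :=
    fun t c k b f hp hk => kept_of_guard (h.parent_guard t c k b f hp hk) rfl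
  clear h
  cases hs
  all_goals
    try simp only [State.goto, State.setRes, State.setResEra, State.setResTag, State.setStRes,
      State.setRef, State.setStatus, State.gpReturn, update_apply, ite_apply]
    first
      | intro w
        by_cases hw : w = t
        · subst hw
          simp only [if_true, PC.helping, reduceCtorEq, false_imp_iff, implies_true]
        · simp only [if_neg hw]
          exact h_keep w
      | grind [Caller.cont_cases, PC.helping]

theorem Inv.step_safe {σ σ' : State n m β} {t : Fin n} {x : Act β} (h : Inv σ)
    (hs : Step σ t x σ') : Safe σ' where
  refs := h.step_refs hs
  parentRead := h.step_parentRead hs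
  posted := h.step_posted hs
  fast := h.step_fast hs
  check := h.step_check hs
  cancel := h.step_cancel hs
  cancelTag := h.step_cancelTag hs
  handover := h.step_handover hs
  setTag := h.step_setTag hs
  gpEnd := h.step_gpEnd hs
  gpEnd_res := h.step_gpEnd_res hs
  helpCheck := h.step_helpCheck hs
  helpCas := h.step_helpCas hs
  helping := h.step_helping hs

end

/-! ### Reachable states -/

theorem Initial.inv {σ : State n m β} (h : Initial σ) : Inv σ := by
  obtain ⟨-, -, h1, h2, h3, h4, h5, h6⟩ := h
  refine ⟨?_, ?_, ?_, ?_, ?_⟩ <;> constructor <;>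
    simp [h1, h2, h3, h4, h5, h6, EraOk, PC.args, PC.clock, PC.tracking, PC.looping, PC.active,
      PC.announced, PC.seen, PC.handing, PC.loadEra, PC.parentRead, PC.posted, PC.awaiting,
      PC.helping]

theorem Inv.handedOver_not_free {σ : State n m β} (h : Inv σ) {b : β} (hb : HandedOver σ b) :
    σ.status b ≠ .free := by
  obtain ⟨t, j, e, hj, hr⟩ := hb
  have href : (⟨some b, true⟩ : Loaded β).ref = some b := rfl
  rcases ha : (σ.pc t).awaiting with - | ⟨j', k⟩
  · cases hp : σ.pc t <;> simp [hp, PC.awaiting, PC.requesting] at ha hj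
    · subst hj
      have := (h.proto.cancelTag _ _ _ _ hp).1
      simp [hr] at this
    · subst hj
      exact (h.safe.setTag _ _ _ _ _ _ b hp hr href).not_free
    · subst hj
      exact (h.safe.gpEnd_res _ _ _ _ _ b hp hr href).not_free
  · obtain rfl : j = j' := by
      cases hp : σ.pc t <;> simp_all [PC.awaiting, PC.requesting]
    rcases h.safe.handover _ _ _ _ _ b ha hr href with ⟨-, u, -, hg⟩ | ⟨-, hg⟩
    · exact hg.not_free
    · exact hg.not_free

section
variable [DecidableEq β]

theorem Inv.step {σ σ' : State n m β} {t : Fin n} {x : Act β} (h : Inv σ)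
    (hs : Step σ t x σ') : Inv σ' where
  life := h.life.step hs
  client := h.client.step hs
  clock := h.clock.step hs
  proto := h.proto.step hs
  safe := h.step_safe hs

theorem Reachable.inv {σ : State n m β} (h : Reachable σ) : Inv σ := by
  obtain ⟨σ₀, h0, h⟩ := h
  induction h with
  | refl => exact h0.inv
  | tail _ hs ih =>
    obtain ⟨t, x, hs⟩ := hs
    exact ih.step hs

/-- A step that accesses a block accesses a live block, a block of the acting thread in
`alloc_block()`, `retire()` or `cleanup()`, or a guarded block. -/
theorem Inv.touch {σ σ' : State n m β} (h : Inv σ) {u : Fin n} {b : β}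
    (hs : Step σ u (.touch b) σ') :
    σ.status b = .live ∨ σ.pc u = .alStamp b ∨ σ.pc u = .rtStamp b ∨
    (∃ l r, σ.pc u = .clScan b l r) ∨ ∃ e i s, Guard σ e i s b := by
  have h_refs : ∀ t j, σ.refs t j = some b → ∃ e i s, Guard σ e i s b :=
    fun t j hr => ⟨_, _, _, h.safe.refs t j b hr⟩
  have h_may : ∀ t, ClientMay σ t b → σ.status b = .live ∨ ∃ e i s, Guard σ e i s b :=
    fun t hc => hc.imp_right fun ⟨j, hr⟩ => h_refs t j hr
  have h_ptr : ∀ t a, (σ.pc t).args = some a → a.ptr.act = .touch b →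
      ∃ e i s, Guard σ e i s b := by
    intro t a ha hb
    cases hp : a.ptr with
    | root r => simp [hp, Loc.act] at hb
    | field b' f =>
      obtain ⟨-, j, -, hr⟩ := h.client.parent_field t a ha b' f hp
      have : b' = b := by simpa [hp, Loc.act] using hb
      exact h_refs t j (this ▸ hr)
  have h_parent : ∀ t a, (σ.pc t).args = some a → a.parent = some b →
      ∃ e i s, Guard σ e i s b := by
    intro t a ha hb
    cases hp : a.ptr with
    | root r => simp [h.client.parent_root t a ha r hp] at hb
    | field b' f =>
      obtain ⟨h1, j, -, hr⟩ := h.client.parent_field t a ha b' f hp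
      have : b' = b := by simpa [h1] using hb
      exact h_refs t j (this ▸ hr)
  have h_help : ∀ t l, (σ.pc t).helping = some l → l.act = .touch b →
      ∃ e i s, Guard σ e i s b := by
    intro t l hl hb
    cases l with
    | root r => simp [Loc.act] at hb
    | field b' f =>
      have : b' = b := by simpa [Loc.act] using hb
      exact ⟨_, _, _, h.safe.helping t b f (this ▸ hl)⟩
  generalize hx : Act.touch b = x at hs
  cases hs
  case access hp hc =>
    obtain rfl : b = _ := by simpa using hx
    exact (h_may u hc).imp_right fun hg => .inr (.inr (.inr hg))
  case write l v hp hc =>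
    cases l with
    | root r => simp [Loc.act] at hx
    | field b' f =>
      obtain rfl : b = b' := by simpa [Loc.act] using hx
      exact (h_may u (hc b f rfl)).imp_right fun hg => .inr (.inr (.inr hg))
  case gpFastLoad | gpLoad =>
    rename_i hp
    exact .inr (.inr (.inr (.inr (h_ptr u _ (by rw [hp]; rfl) hx.symm))))
  case gpParentEra =>
    rename_i hp hb
    obtain rfl : b = _ := by simpa using hx
    exact .inr (.inr (.inr (.inr (h_parent u _ (by rw [hp]; rfl) hb))))
  case hLoad =>
    rename_i hp
    exact .inr (.inr (.inr (.inr (h_help u _ (by rw [hp]; rfl) hx.symm))))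
  case alStamp =>
    rename_i hp
    obtain rfl : b = _ := by simpa using hx
    exact .inr (.inl hp)
  case rtStamp =>
    rename_i hp
    obtain rfl : b = _ := by simpa using hx
    exact .inr (.inr (.inl hp))
  case clKeep | clPass =>
    rename_i hp _
    obtain rfl : b = _ := by simpa using hx
    exact .inr (.inr (.inr (.inl ⟨_, _, hp⟩)))
  all_goals simp at hx

/-- Once some scan of `b` has read all reservations, no step accesses `b`. -/
theorem Inv.not_touch_of_scanned {σ : State n m β} (h : Inv σ) {t : Fin n} {b : β} {l : List β}
    (hp : σ.pc t = .clScan b l []) {u : Fin n} {σ' : State n m β}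
    (hs : Step σ u (.touch b) σ') : False := by
  obtain ⟨-, -, hb, -⟩ := h.life.scan t b l [] hp
  have hst := h.life.listed t b hb
  rcases h.touch hs with h1 | h1 | h1 | ⟨l', r, h1⟩ | ⟨e, i, s, hg⟩
  · simp [hst] at h1
  · simp [h.life.allocating u b h1] at hst
  · exact h.life.retiring_not_mem u t b h1 hb
  · obtain rfl := h.life.listed_unique u t b (h.life.scan u b l' r h1).2.2.1 hb
    generalize hx : Act.touch b = x at hs
    cases hs <;> simp_all
  · simpa using hg.scan t l [] hp

/-- A thread at the end of a scan of `b` is stuck unless it reclaims `b`. -/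
theorem scanned_stays {σ σ' : State n m β} {t u : Fin n} {b : β} {l : List β} {x : Act β}
    (hp : σ.pc t = .clScan b l []) (hx : x ≠ .free b) (hs : Step σ u x σ') :
    σ'.pc t = .clScan b l [] := by
  cases hs
  all_goals
    try simp only [State.goto, State.setRes, State.setResEra, State.setResTag, State.setStRes,
      State.setRef, State.setStatus, State.gpReturn, update_apply]
    grind

theorem Inv.not_mayStillAccess {σ : State n m β} (h : Inv σ) {t : Fin n} {b : β} {l : List β}
    (hp : σ.pc t = .clScan b l []) (u : Fin n) : ¬ MayStillAccess σ u b := by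
  rintro ⟨τ, τ', hr, hs⟩
  have key : Inv τ ∧ τ.pc t = .clScan b l [] := by
    clear hs
    induction hr with
    | refl => exact ⟨h, hp⟩
    | tail _ hs ih =>
      obtain ⟨v, x, hx, hs⟩ := hs
      exact ⟨ih.1.step hs, scanned_stays ih.2 hx hs⟩
  exact key.1.not_touch_of_scanned key.2 hs

theorem Step.pc_of_free {σ σ' : State n m β} {t : Fin n} {b : β} (hs : Step σ t (.free b) σ') :
    ∃ l, σ.pc t = .clScan b l [] := by
  generalize hx : Act.free b = x at hs
  cases hs
  case clFree l hp => exact ⟨l, by simp_all⟩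
  all_goals first | simp at hx | (revert hx; unfold Loc.act; split <;> simp)

end

end WFE

theorem mainTheorem4 {n m : ℕ} {β : Type*} [DecidableEq β] (σ : WFE.State n m β)
    (hσ : WFE.Reachable σ) :
    -- cleanup() reclaims only retired blocks that no thread may still access
    (∀ (t : Fin n) (b : β) (σ' : WFE.State n m β), WFE.Step σ t (.free b) σ' →
      σ.status b = .retired ∧ ∀ u : Fin n, ¬ WFE.MayStillAccess σ u b) ∧
    -- no step accesses a reclaimed block
    (∀ (t : Fin n) (b : β) (σ' : WFE.State n m β), WFE.Step σ t (.touch b) σ' →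
      σ.status b ≠ .free) ∧
    -- parent blocks during helping, objects being handed over, and blocks with protected
    -- references are not reclaimed
    (∀ b : β, WFE.HelpedParent σ b ∨ WFE.HandedOver σ b ∨ WFE.Referenced σ b →
      σ.status b ≠ .free) := by
  have h := hσ.inv
  refine ⟨fun t b σ' hs => ?_, fun t b σ' hs => ?_, fun b hb => ?_⟩
  · obtain ⟨l, hp⟩ := hs.pc_of_free
    exact ⟨h.life.listed t b (h.life.scan t b l [] hp).2.2.1, h.not_mayStillAccess hp⟩
  · rcases h.touch hs with h1 | h1 | h1 | ⟨l, r, h1⟩ | ⟨e, i, s, hg⟩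
    · simp [h1]
    · simp [h.life.allocating t b h1]
    · simp [h.life.retiring t b h1]
    · simp [h.life.listed t b (h.life.scan t b l r h1).2.2.1]
    · exact hg.not_free
  · rcases hb with ⟨t, f, hp⟩ | hb | ⟨t, j, hr⟩
    · exact (h.safe.helping t b f hp).not_free
    · exact h.handedOver_not_free hb
    · exact (h.safe.refs t j b hr).not_free
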